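/- **Corollary 3.1.** Let $l,a>0$, $J_1=(-l,l)$, $J_2=(-a,a)$, $\Omega_0=J_1\times J_2$. Let $f$ be a real-valued measurable function on $\Omega_0$ with $f>0$ a.e. and $f,f^{-1}\in L^\infty(\Omega_0)$, possessing boundary values $f(x_1,\pm a)=\lim_{x_2\to\pm a}f(x_1,x_2)$ (limits from inside $\Omega_0$) for a.e. $x_1\in J_1$; for instance $f$ may be continuous and positive on $\overline{\Omega_0}$. Equip $\Omega_0$ with the Riemannian metric $G=\mathrm{diag}(f^2,1)$ and let $L^2(\Omega_0,G)$ be the complex Hilbert space with inner product $$(\varphi,\psi)_G=\int_{\Omega_0}\overline{\varphi}\,\psi\,f\,dx .$$ Let $\alpha,\beta,b,c,\phi$ be real-valued measurable functions on $J_1$ with $b>0$, $c\ge -1/b$, $\phi\in[-\pi,\pi)$ a.e. and $b,1/b,c,\alpha,\beta\in L^\infty(J_1)$, and put $$B=\begin{pmatrix}\sqrt{1+bc}\,e^{i\phi}&b\\ c&\sqrt{1+bc}\,e^{-i\phi}\end{pmatrix}.$$ Let $W^{1,2}_{\rm per}(\Omega_0)$ be the space of all $\psi\in W^{1,2}(\Omega_0)$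 whose boundary traces satisfy $\psi(-l,x_2)=\psi(l,x_2)$ for a.e. $x_2\in J_2$. With $(\mathcal P\psi)(x_1,x_2)=\psi(x_1,-x_2)$ and, in the sense of traces, $$(\varphi,\psi)_G^{\pm}=\int_{-l}^{l}\overline{\varphi(x_1,\pm a)}\,\psi(x_1,\pm a)\,f(x_1,\pm a)\,dx_1 ,$$ define for $\varphi,\psi\in W^{1,2}_{\rm per}(\Omega_0)$ the sesquilinear forms $h_\iota=h^1+h^2_\iota$, $\iota\in\{\mathrm I,\mathrm{II}\}$, by $$h^1(\varphi,\psi)=(f^{-1}\partial_1\varphi,f^{-1}\partial_1\psi)_G+(\partial_2\varphi,\partial_2\psi)_G,$$ $$h^2_{\mathrm I}(\varphi,\psi)=(\varphi,(\beta+i\alpha)\psi)_G^{+}+(\varphi,(\beta-i\alpha)\psi)_G^{-},$$ $$h^2_{\mathrm{II}}(\varphi,\psi)=(\varphi,B_{12}^{-1}\mathcal P\psi)_G^{+}+(\varphi,B_{12}^{-1}\mathcal P\psi)_G^{-}-(\varphi,B_{22}B_{12}^{-1}\psi)_G^{+}-(\varphi,B_{11}B_{12}^{-1}\psi)_G^{-}.$$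 Then for each $\iota\in\{\mathrm I,\mathrm{II}\}$ there is an m-sectorial operator $\tilde H_\iota$ in $L^2(\Omega_0,G)$ (densely defined, with numerical range in a sector $\{\zeta:|\arg(\zeta-\gamma)|\le\theta\}$, $\gamma\in\mathbb R$, $0\le\theta<\pi/2$, and quasi-m-accretive) with domain $$\mathrm{Dom}(\tilde H_\iota)=\{\psi\in W^{1,2}_{\rm per}(\Omega_0)\mid \exists F\in L^2(\Omega_0,G)\ \forall\varphi\in W^{1,2}_{\rm per}(\Omega_0):\ h_\iota(\varphi,\psi)=(\varphi,F)_G\}$$ such that $$h_\iota(\varphi,\psi)=(\varphi,\tilde H_\iota\psi)_G\qquad\text{for all }\psi\in\mathrm{Dom}(\tilde H_\iota),\ \varphi\in W^{1,2}_{\rm per}(\Omega_0).\tag{$*$}$$ Moreover $\tilde H_\iota$ is the only m-sectorial operator in $L^2(\Omega_0,G)$ whose domain is contained in $W^{1,2}_{\rm per}(\Omega_0)$ and which satisfies $(*)$. -/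

import Mathlib

open MeasureTheory Set Filter Topology
open scoped ContDiff ComplexConjugate

namespace PTStrip

/-! ### Operators in a Hilbert space -/

section Operators

variable {H : Type*} [NormedAddCommGroup H] [InnerProductSpace ℂ H]

/-- The bounded everywhere defined operator `R` is the resolvent `(T - z)⁻¹`. -/
def IsResolventAt (T : H →ₗ.[ℂ] H) (z : ℂ) (R : H →L[ℂ] H) : Prop :=
  (∀ x : H, ∃ hx : R x ∈ T.domain, T ⟨R x, hx⟩ - z • R x = x) ∧
    ∀ y : T.domain, R (T y - z • (y : H)) = y

/-- `T + r` is m-accretive for some real `r`: for `Re w > 0` the operator `(T + r + w)⁻¹` is bounded,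
everywhere defined, and of norm at most `1 / Re w`. -/
def IsQuasiMAccretive (T : H →ₗ.[ℂ] H) : Prop :=
  ∃ r : ℝ, ∀ w : ℂ, 0 < w.re →
    ∃ R : H →L[ℂ] H, IsResolventAt T (-((r : ℂ) + w)) R ∧ ‖R‖ ≤ 1 / w.re

/-- The numerical range of `T` lies in a sector `{ζ | |arg (ζ - γ)| ≤ θ}` with real vertex `γ` and
semi-angle `0 ≤ θ < π / 2`. -/
def IsSectorial (T : H →ₗ.[ℂ] H) : Prop :=
  ∃ γ θ : ℝ, 0 ≤ θ ∧ θ < Real.pi / 2 ∧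
    ∀ u : T.domain, ‖(u : H)‖ = 1 → |(inner ℂ (u : H) (T u) - (γ : ℂ)).arg| ≤ θ

/-- m-sectorial operators: densely defined, sectorial and quasi-m-accretive. -/
def IsMSectorial (T : H →ₗ.[ℂ] H) : Prop :=
  Dense (T.domain : Set H) ∧ IsSectorial T ∧ IsQuasiMAccretive T

end Operators

/-! ### The rectangle and the Hilbert space -/

/-- The open rectangle `(-l, l) × (-a, a)`. -/
def rect (l a : ℝ) : Set (ℝ × ℝ) := Ioo (-l) l ×ˢ Ioo (-a) a

/-- The Riemannian measure `|G|^{1/2} dx = f dx` on the rectangle, for the metric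
`G = diag (f², 1)` with `f > 0`. -/
noncomputable def muG (l a : ℝ) (f : ℝ × ℝ → ℝ) : Measure (ℝ × ℝ) :=
  (volume.restrict (rect l a)).withDensity fun x => ENNReal.ofReal (f x)

/-- The Hilbert space of square-integrable functions for the Riemannian measure; its inner product is
conjugate-linear in the first argument. -/
abbrev L2G (l a : ℝ) (f : ℝ × ℝ → ℝ) : Type := Lp ℂ 2 (muG l a f)

/-- The pairing `∫ conj u * v * f dx` over the rectangle. -/
noncomputable def innerG (l a : ℝ) (f : ℝ × ℝ → ℝ) (u v : ℝ × ℝ → ℂ) : ℂ :=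
  ∫ x, conj (u x) * v x ∂(muG l a f)

/-! ### The Sobolev space of the rectangle and traces -/

/-- `g` is a square-integrable weak derivative of `u` in the direction `e` on the open set `U`
(square-integrability is with respect to Lebesgue measure). -/
def IsWeakPartial (U : Set (ℝ × ℝ)) (e : ℝ × ℝ) (u g : ℝ × ℝ → ℂ) : Prop :=
  MemLp g 2 (volume.restrict U) ∧
    ∀ η : ℝ × ℝ → ℝ, ContDiff ℝ ∞ η → HasCompactSupport η → tsupport η ⊆ U →
      ∫ x in U, fderiv ℝ η x e • u x = - ∫ x in U, η x • g x

open Classical in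
/-- The square-integrable weak derivative (unique up to null sets; zero if there is none). -/
noncomputable def weakPartial (U : Set (ℝ × ℝ)) (e : ℝ × ℝ) (u : ℝ × ℝ → ℂ) : ℝ × ℝ → ℂ :=
  if h : ∃ g, IsWeakPartial U e u g then h.choose else 0

/-- `∂₁ u` on the rectangle. -/
noncomputable def d1 (l a : ℝ) (u : ℝ × ℝ → ℂ) : ℝ × ℝ → ℂ := weakPartial (rect l a) (1, 0) u

/-- `∂₂ u` on the rectangle. -/
noncomputable def d2 (l a : ℝ) (u : ℝ × ℝ → ℂ) : ℝ × ℝ → ℂ := weakPartial (rect l a) (0, 1) u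

/-- The Sobolev space `W^{1,2}` of the rectangle. -/
def MemW12 (l a : ℝ) (u : ℝ × ℝ → ℂ) : Prop :=
  MemLp u 2 (volume.restrict (rect l a)) ∧
    (∃ g, IsWeakPartial (rect l a) (1, 0) u g) ∧ ∃ g, IsWeakPartial (rect l a) (0, 1) u g

/-- `t` is the boundary trace of the Sobolev function `u`: it is square-integrable on each of the four
sides of the rectangle, and the Gauss-Green formula holds for every function `η` smooth up to the
boundary. Only the values of `t` on the sides matter, and there `t` is determined up to null sets. -/
structure IsTrace (l a : ℝ) (u t : ℝ × ℝ → ℂ) : Prop where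
  memLp_right : MemLp (fun y => t (l, y)) 2 (volume.restrict (Ioo (-a) a))
  memLp_left : MemLp (fun y => t (-l, y)) 2 (volume.restrict (Ioo (-a) a))
  memLp_top : MemLp (fun x => t (x, a)) 2 (volume.restrict (Ioo (-l) l))
  memLp_bot : MemLp (fun x => t (x, -a)) 2 (volume.restrict (Ioo (-l) l))
  green₁ : ∀ η : ℝ × ℝ → ℝ, ContDiff ℝ ∞ η →
    ∫ x in rect l a, (fderiv ℝ η x (1, 0) • u x + η x • d1 l a u x) =
      (∫ y in Ioo (-a) a, η (l, y) • t (l, y)) - ∫ y in Ioo (-a) a, η (-l, y) • t (-l, y)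
  green₂ : ∀ η : ℝ × ℝ → ℝ, ContDiff ℝ ∞ η →
    ∫ x in rect l a, (fderiv ℝ η x (0, 1) • u x + η x • d2 l a u x) =
      (∫ x in Ioo (-l) l, η (x, a) • t (x, a)) - ∫ x in Ioo (-l) l, η (x, -a) • t (x, -a)

open Classical in
/-- The boundary trace of a Sobolev function. -/
noncomputable def trace (l a : ℝ) (u : ℝ × ℝ → ℂ) : ℝ × ℝ → ℂ :=
  if h : ∃ t, IsTrace l a u t then h.choose else 0

/-- The space `W^{1,2}_per`: Sobolev functions with equal traces on the sides `x₁ = -l` and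
`x₁ = l`. -/
def MemW12per (l a : ℝ) (u : ℝ × ℝ → ℂ) : Prop :=
  MemW12 l a u ∧
    ∀ᵐ y ∂(volume.restrict (Ioo (-a) a)), trace l a u (-l, y) = trace l a u (l, y)

/-! ### The sesquilinear forms -/

/-- The pairing `∫ conj (u (x₁, s)) v (x₁, s) f (x₁, s) dx₁` on the horizontal side `x₂ = s`. -/
noncomputable def bdryInner (l : ℝ) (f : ℝ × ℝ → ℝ) (s : ℝ) (u v : ℝ × ℝ → ℂ) : ℂ :=
  ∫ x in Ioo (-l) l, conj (u (x, s)) * v (x, s) * (f (x, s) : ℂ)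

/-- Reflection in the second variable. -/
def parity (u : ℝ × ℝ → ℂ) : ℝ × ℝ → ℂ := fun x => u (x.1, -x.2)

/-- The form `h¹` of the Laplace-Beltrami operator. -/
noncomputable def form1 (l a : ℝ) (f : ℝ × ℝ → ℝ) (φ ψ : ℝ × ℝ → ℂ) : ℂ :=
  innerG l a f (fun x => ((f x)⁻¹ : ℂ) * d1 l a φ x) (fun x => ((f x)⁻¹ : ℂ) * d1 l a ψ x) +
    innerG l a f (d2 l a φ) (d2 l a ψ)

/-- The form `h_I` of the separated boundary conditions. -/
noncomputable def formI (l a : ℝ) (f : ℝ × ℝ → ℝ) (α β : ℝ → ℝ) (φ ψ : ℝ × ℝ → ℂ) : ℂ :=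
  form1 l a f φ ψ +
    (bdryInner l f a (trace l a φ)
        (fun x => ((β x.1 : ℂ) + Complex.I * (α x.1 : ℂ)) * trace l a ψ x) +
      bdryInner l f (-a) (trace l a φ)
        (fun x => ((β x.1 : ℂ) - Complex.I * (α x.1 : ℂ)) * trace l a ψ x))

/-- The matrix of the connected boundary conditions (indices `0, 1` instead of `1, 2`). -/
noncomputable def matB (b c ϕ : ℝ → ℝ) (s : ℝ) : Matrix (Fin 2) (Fin 2) ℂ :=
  !![(Real.sqrt (1 + b s * c s) : ℂ) * Complex.exp (Complex.I * (ϕ s : ℂ)), (b s : ℂ);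
    (c s : ℂ), (Real.sqrt (1 + b s * c s) : ℂ) * Complex.exp (-(Complex.I * (ϕ s : ℂ)))]

/-- The form `h_II` of the connected boundary conditions. -/
noncomputable def formII (l a : ℝ) (f : ℝ × ℝ → ℝ) (b c ϕ : ℝ → ℝ) (φ ψ : ℝ × ℝ → ℂ) : ℂ :=
  form1 l a f φ ψ +
    (bdryInner l f a (trace l a φ)
        (fun x => (matB b c ϕ x.1 0 1)⁻¹ * parity (trace l a ψ) x) +
      bdryInner l f (-a) (trace l a φ)
        (fun x => (matB b c ϕ x.1 0 1)⁻¹ * parity (trace l a ψ) x) -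
      bdryInner l f a (trace l a φ)
        (fun x => matB b c ϕ x.1 1 1 * (matB b c ϕ x.1 0 1)⁻¹ * trace l a ψ x) -
      bdryInner l f (-a) (trace l a φ)
        (fun x => matB b c ϕ x.1 0 0 * (matB b c ϕ x.1 0 1)⁻¹ * trace l a ψ x))

/-- `Dom T ⊆ W^{1,2}_per` and `h (φ, ψ) = (φ, T ψ)_G` for `ψ ∈ Dom T` and `φ ∈ W^{1,2}_per`. -/
def Represents {l a : ℝ} {f : ℝ × ℝ → ℝ} (h : (ℝ × ℝ → ℂ) → (ℝ × ℝ → ℂ) → ℂ)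
    (T : L2G l a f →ₗ.[ℂ] L2G l a f) : Prop :=
  ∀ ψ : T.domain, MemW12per l a (ψ : L2G l a f) ∧
    ∀ φ : L2G l a f, MemW12per l a φ → h φ (ψ : L2G l a f) = inner ℂ φ (T ψ)

/-- `ψ ∈ W^{1,2}_per` and `h (·, ψ) = (·, F)_G` on `W^{1,2}_per` for some square-integrable `F`. -/
def MemFormOpDomain {l a : ℝ} {f : ℝ × ℝ → ℝ} (h : (ℝ × ℝ → ℂ) → (ℝ × ℝ → ℂ) → ℂ)
    (ψ : L2G l a f) : Prop :=
  MemW12per l a ψ ∧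
    ∃ F : L2G l a f, ∀ φ : L2G l a f, MemW12per l a φ → h φ ψ = inner ℂ φ F

end PTStrip

open PTStrip

/-! # m-sectorial realisations of Robin-type Laplace-Beltrami operators on a strip

Both forms have the shape `form1` plus bounded couplings between the traces on the two horizontal
sides, and `exists_unique_operator` treats all such forms at once. The triples `(u, ∂₁ u, ∂₂ u)`
with `u` in the periodic Sobolev space form a closed subspace `V` of `L² × L² × L²`
(`exists_formSpace`), because the weak derivatives and the periodicity are expressed by the
vanishing of integrals against test functions (for the periodicity: `memW12per_iff`). So `V` is a
Hilbert space, embedded injectively and densely into `L²(Ω₀, G)`, and on it the form is `⟪φ, A v⟫`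
with a bounded operator `A`. A Gårding inequality `c ‖v‖² ≤ Re ⟪v, A v⟫ + κ ‖u‖²` for `v = (u, ∂₁
u, ∂₂ u)` gives the rest: by Lax-Milgram the form operator `T` has the resolvent `(T + κ + w)⁻¹`
for `Re w > 0`, the bounds on real and imaginary parts of the form give the sector, and a
quasi-m-accretive operator has no proper quasi-m-accretive restriction
(`IsQuasiMAccretive.eq_of_le`), which is the uniqueness.

The Gårding inequality requires traces that are small relative to `∂₂ u`. Both the existence of
traces and this smallness come from one formula: if `p` is smooth with `p (a) = 1` and `p (-a) =
0`, then the trace of `u` on `x₂ = a` is `∫ (p' u + p ∂₂ u) dx₂` (`sideValue`, `green_sideValue`,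
`trace_top_ae_eq`). Its norm is at most `‖p'‖ ‖u‖ + ‖p‖ ‖∂₂ u‖`, and `‖p‖` is as small as desired
for a high power of the affine weight (`exists_trace_clm`).

The Gauss-Green formula behind this is the definition of the weak derivative, extended from
compactly supported test functions to those that only vanish on two opposite sides
(`weak_green_of_vanishing`). The vertical sides are reduced to the horizontal ones by exchanging
the coordinates.
-/

namespace PTStrip

/-! ### The representation theorem for coercive forms -/

section Representation

variable {V H : Type*} [NormedAddCommGroup V] [InnerProductSpace ℂ V]
  [NormedAddCommGroup H] [InnerProductSpace ℂ H]

/-- The Lax-Milgram lemma for the sesquilinear form `⟪u, B v⟫`. -/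
theorem bijective_of_coercive [CompleteSpace V] (B : V →L[ℂ] V) {c : ℝ} (hc : 0 < c)
    (h : ∀ v, c * ‖v‖ ^ 2 ≤ (inner ℂ v (B v)).re) : Function.Bijective B := by
  have bound (v : V) : c * ‖v‖ ≤ ‖B v‖ := by
    rcases (norm_nonneg v).eq_or_lt with h0 | h0
    · rw [← h0]; simp
    · have h1 := (h v).trans ((Complex.re_le_norm _).trans (norm_inner_le_norm v (B v)))
      nlinarith
  have hanti : AntilipschitzWith (c⁻¹).toNNReal B := by
    refine B.antilipschitz_of_bound fun v => ?_
    rw [Real.coe_toNNReal _ (inv_pos.2 hc).le, ← div_eq_inv_mul, le_div_iff₀ hc, mul_comm]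
    exact bound v
  refine ⟨hanti.injective, ?_⟩
  have hclosed : IsClosed (B.range : Set V) := hanti.isClosed_range B.uniformContinuous
  have := hclosed.completeSpace_coe
  change Function.Surjective (B : V →ₗ[ℂ] V)
  rw [← LinearMap.range_eq_top, ← B.range.orthogonal_orthogonal, Submodule.eq_top_iff']
  intro v w hw
  have h1 : inner ℂ w (B w) = 0 := by
    rw [← inner_conj_symm]
    exact (congrArg _ (hw _ ⟨w, rfl⟩)).trans (map_zero _)
  have h2 := h w
  rw [h1, Complex.zero_re] at h2
  have : ‖w‖ = 0 := by
    have := sq_nonneg ‖w‖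
    exact pow_eq_zero_iff (two_ne_zero) |>.1 (by nlinarith)
  rw [norm_eq_zero.1 this, inner_zero_left]

theorem re_mul_inner_self (z : ℂ) (x : H) : (z * inner ℂ x x).re = z.re * ‖x‖ ^ 2 := by
  have h : inner ℂ x x = ((‖x‖ ^ 2 : ℝ) : ℂ) := by
    rw [inner_self_eq_norm_sq_to_K]; push_cast; rfl
  rw [h, Complex.re_mul_ofReal]

/-- The graph of the operator associated with the form `⟪φ, A v⟫` on `V`, seen in `H` through the
embedding `j`. -/
def formGraph (j : V →L[ℂ] H) (A : V →L[ℂ] V) : Submodule ℂ (H × H) where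
  carrier := {p | ∃ v, j v = p.1 ∧ ∀ φ, inner ℂ φ (A v) = inner ℂ (j φ) p.2}
  add_mem' := by
    rintro p q ⟨v, hv, hv'⟩ ⟨w, hw, hw'⟩
    refine ⟨v + w, by simp [hv, hw], fun φ => ?_⟩
    simp [hv', hw']
  zero_mem' := ⟨0, by simp, by simp⟩
  smul_mem' := by
    rintro k p ⟨v, hv, hv'⟩
    refine ⟨k • v, by simp [hv], fun φ => ?_⟩
    simp [hv']

/-- The operator associated with the form `⟪φ, A v⟫` on `V`: it maps `j v` to the element `y` of `H`
with `⟪φ, A v⟫ = ⟪j φ, y⟫` for all `φ`. This is single-valued if `j` is injective with dense range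
(`formOperator_iff`). -/
noncomputable def formOperator (j : V →L[ℂ] H) (A : V →L[ℂ] V) : H →ₗ.[ℂ] H :=
  (formGraph j A).toLinearPMap

variable {j : V →L[ℂ] H} {A : V →L[ℂ] V}

theorem formOperator_iff (hj : Function.Injective j) (hd : DenseRange j) {x y : H} :
    (∃ hx : x ∈ (formOperator j A).domain, formOperator j A ⟨x, hx⟩ = y) ↔
      ∃ v, j v = x ∧ ∀ φ, inner ℂ φ (A v) = inner ℂ (j φ) y := by
  have hg : (formOperator j A).graph = formGraph j A := by
    refine Submodule.toLinearPMap_graph_eq _ ?_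
    rintro ⟨p, q⟩ ⟨v, hv, hv'⟩ (h0 : p = 0)
    have hv0 : v = 0 := hj (by simpa [h0] using hv)
    refine hd.eq_zero_of_inner_right (𝕜 := ℂ) fun φ => ?_
    rw [← hv' φ, hv0, map_zero, inner_zero_right]
  have : ((x, y) ∈ (formOperator j A).graph) ↔ (x, y) ∈ formGraph j A := by rw [hg]
  rw [LinearPMap.mem_graph_iff] at this
  refine Iff.trans ⟨?_, ?_⟩ this
  · rintro ⟨hx, h⟩; exact ⟨⟨x, hx⟩, rfl, h⟩
  · rintro ⟨z, rfl, h⟩; exact ⟨z.2, h⟩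

theorem formOperator_inner (hj : Function.Injective j) (hd : DenseRange j)
    (x : (formOperator j A).domain) :
    ∃ v, j v = x ∧ ∀ φ, inner ℂ φ (A v) = inner ℂ (j φ) (formOperator j A x) :=
  (formOperator_iff hj hd).1 ⟨x.2, rfl⟩

theorem formOperator_isSectorial (hj : Function.Injective j) (hd : DenseRange j)
    {c κ : ℝ} (hc : 0 < c)
    (hA : ∀ v, c * ‖v‖ ^ 2 ≤ (inner ℂ v (A v)).re + κ * ‖j v‖ ^ 2) :
    IsSectorial (formOperator j A) := by
  refine ⟨-κ, Real.arctan (‖A‖ / c), Real.arctan_nonneg.2 (by positivity),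
    Real.arctan_lt_pi_div_two _, fun u hu => ?_⟩
  obtain ⟨v, hv, hv'⟩ := formOperator_inner hj hd u
  rw [← hv] at hu
  rw [← hv, ← hv']
  set z := inner ℂ v (A v) - ((-κ : ℝ) : ℂ) with hz
  have hre : c * ‖v‖ ^ 2 ≤ z.re := by
    have := hA v
    rw [hu] at this
    simp only [hz, Complex.sub_re, Complex.ofReal_re]
    linarith
  have him : |z.im| ≤ ‖A‖ * ‖v‖ ^ 2 := by
    have h1 : z.im = (inner ℂ v (A v)).im := by simp [hz]
    rw [h1]
    calc _ ≤ ‖inner ℂ v (A v)‖ := Complex.abs_im_le_norm _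
      _ ≤ ‖v‖ * ‖A v‖ := norm_inner_le_norm _ _
      _ ≤ ‖v‖ * (‖A‖ * ‖v‖) := by gcongr; exact A.le_opNorm v
      _ = _ := by ring
  have hvpos : 0 < ‖v‖ := by
    rw [norm_pos_iff]; rintro rfl; simp at hu
  have hzre : 0 < z.re := lt_of_lt_of_le (by positivity) hre
  have harg : z.arg = Real.arctan (z.im / z.re) := by
    rw [← Complex.tan_arg, Real.arctan_tan]
    · exact (abs_lt.1 (Complex.abs_arg_lt_pi_div_two_iff.2 (Or.inl hzre))).1
    · exact (abs_lt.1 (Complex.abs_arg_lt_pi_div_two_iff.2 (Or.inl hzre))).2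
  have hq : |z.im / z.re| ≤ ‖A‖ / c := by
    rw [abs_div, abs_of_pos hzre, div_le_div_iff₀ hzre hc]
    calc |z.im| * c ≤ ‖A‖ * ‖v‖ ^ 2 * c := by gcongr
      _ = ‖A‖ * (c * ‖v‖ ^ 2) := by ring
      _ ≤ _ := by gcongr
  rw [harg, abs_le, ← Real.arctan_neg]
  exact ⟨Real.arctan_strictMono.monotone (abs_le.1 hq).1,
    Real.arctan_strictMono.monotone (abs_le.1 hq).2⟩

variable [CompleteSpace V] [CompleteSpace H]

/-- Under the Gårding inequality, the equation `(T + κ + w) u = x` for the operator `T` of the form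
is uniquely solvable if `Re w ≥ 0`; `j ∘ S` is the resolvent. -/
theorem exists_solution_operator {c κ : ℝ} (hc : 0 < c)
    (hA : ∀ v, c * ‖v‖ ^ 2 ≤ (inner ℂ v (A v)).re + κ * ‖j v‖ ^ 2) {w : ℂ} (hw : 0 ≤ w.re) :
    ∃ S : H →L[ℂ] V, ∀ v x, S x = v ↔
      ∀ φ, inner ℂ φ (A v) + (κ + w) * inner ℂ (j φ) (j v) = inner ℂ (j φ) x := by
  let B : V →L[ℂ] V := A + ((κ : ℂ) + w) • (j.adjoint ∘L j)
  have hB (φ v : V) : inner ℂ φ (B v) = inner ℂ φ (A v) + (κ + w) * inner ℂ (j φ) (j v) := by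
    simp [B, ContinuousLinearMap.adjoint_inner_right]
  have hcoer (v : V) : c * ‖v‖ ^ 2 ≤ (inner ℂ v (B v)).re := by
    have h1 : (((κ : ℂ) + w) * inner ℂ (j v) (j v)).re = (κ + w.re) * ‖j v‖ ^ 2 := by
      rw [re_mul_inner_self]; simp
    rw [hB, Complex.add_re, h1]
    nlinarith [hA v, mul_nonneg hw (sq_nonneg ‖j v‖)]
  have hbij := bijective_of_coercive B hc hcoer
  let E := ContinuousLinearEquiv.ofBijective B (LinearMap.ker_eq_bot.2 hbij.1)
    (LinearMap.range_eq_top.2 hbij.2)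
  refine ⟨E.symm.toContinuousLinearMap ∘L j.adjoint, fun v x => ?_⟩
  have h1 : (E.symm.toContinuousLinearMap ∘L j.adjoint) x = v ↔ B v = j.adjoint x := by
    change E.symm (j.adjoint x) = v ↔ E v = j.adjoint x
    rw [ContinuousLinearEquiv.symm_apply_eq]
    exact eq_comm
  rw [h1]
  constructor
  · intro h φ
    rw [← hB, h, ContinuousLinearMap.adjoint_inner_right]
  · intro h
    refine ext_inner_left ℂ fun φ => ?_
    rw [hB, h, ContinuousLinearMap.adjoint_inner_right]

theorem formOperator_isQuasiMAccretive (hj : Function.Injective j) (hd : DenseRange j)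
    {c κ : ℝ} (hc : 0 < c)
    (hA : ∀ v, c * ‖v‖ ^ 2 ≤ (inner ℂ v (A v)).re + κ * ‖j v‖ ^ 2) :
    IsQuasiMAccretive (formOperator j A) := by
  refine ⟨κ, fun w hw => ?_⟩
  obtain ⟨S, hS⟩ := exists_solution_operator hc hA hw.le
  refine ⟨j ∘L S, ⟨fun x => ?_, fun y => ?_⟩, ?_⟩
  · obtain ⟨hx, hTx⟩ := (formOperator_iff (A := A) hj hd (x := j (S x))
      (y := x - ((κ : ℂ) + w) • j (S x))).2 ⟨S x, rfl, fun φ => by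
        rw [inner_sub_right, inner_smul_right, ← (hS _ x).1 rfl φ]; ring⟩
    refine ⟨hx, ?_⟩
    change formOperator j A ⟨j (S x), hx⟩ - _ • j (S x) = x
    rw [hTx]
    module
  · obtain ⟨v, hv, hv'⟩ := formOperator_inner hj hd y
    rw [← hv]
    refine congrArg j ((hS v _).2 fun φ => ?_)
    rw [hv', inner_sub_right, inner_smul_right]; ring
  · refine ContinuousLinearMap.opNorm_le_bound _ (by positivity) fun x => ?_
    set v := S x with hv
    have h1 := congrArg Complex.re ((hS v x).1 rfl v)
    have h2 : (((κ : ℂ) + w) * inner ℂ (j v) (j v)).re = (κ + w.re) * ‖j v‖ ^ 2 := by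
      rw [re_mul_inner_self]; simp
    rw [Complex.add_re, h2] at h1
    have h3 : (inner ℂ (j v) x).re ≤ ‖j v‖ * ‖x‖ :=
      (Complex.re_le_norm _).trans (norm_inner_le_norm _ _)
    have h4 : 0 ≤ c * ‖v‖ ^ 2 := by positivity
    change ‖j v‖ ≤ _
    rw [one_div, ← div_eq_inv_mul, le_div_iff₀ hw]
    rcases (norm_nonneg (j v)).eq_or_lt with h0 | h0
    · rw [← h0]; simp
    · nlinarith [hA v]

theorem formOperator_dense_domain (hj : Function.Injective j) (hd : DenseRange j)
    {c κ : ℝ} (hc : 0 < c)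
    (hA : ∀ v, c * ‖v‖ ^ 2 ≤ (inner ℂ v (A v)).re + κ * ‖j v‖ ^ 2) :
    Dense ((formOperator j A).domain : Set H) := by
  obtain ⟨S, hS⟩ := exists_solution_operator (w := 0) hc hA le_rfl
  rw [Submodule.dense_iff_topologicalClosure_eq_top, Submodule.topologicalClosure_eq_top_iff,
    Submodule.eq_bot_iff]
  intro y hy
  set v := S y with hv
  have hmem : j v ∈ (formOperator j A).domain := by
    obtain ⟨hx, -⟩ := (formOperator_iff (A := A) hj hd (x := j v)
      (y := y - (κ : ℂ) • j v)).2 ⟨v, rfl, fun φ => by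
        rw [inner_sub_right, inner_smul_right, ← (hS _ y).1 rfl φ]; ring⟩
    exact hx
  have h1 := congrArg Complex.re ((hS v y).1 rfl v)
  have h2 : (((κ : ℂ) + 0) * inner ℂ (j v) (j v)).re = κ * ‖j v‖ ^ 2 := by
    rw [re_mul_inner_self]; simp
  rw [Complex.add_re, h2, hy _ hmem, Complex.zero_re] at h1
  have h3 : v = 0 := by
    rw [← norm_eq_zero]
    exact pow_eq_zero_iff (two_ne_zero) |>.1 (by nlinarith [hA v, sq_nonneg ‖v‖])
  have h4 := (hS v y).1 rfl
  refine hd.eq_zero_of_inner_right (𝕜 := ℂ) fun φ => ?_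
  rw [← h4 φ, h3]
  simp

end Representation

/-- A quasi-m-accretive operator has no proper quasi-m-accretive restriction: far to the left in the
complex plane both have resolvents. -/
theorem IsQuasiMAccretive.eq_of_le {H : Type*} [NormedAddCommGroup H] [InnerProductSpace ℂ H]
    {T' T : H →ₗ.[ℂ] H} (hT' : IsQuasiMAccretive T') (hT : IsQuasiMAccretive T) (h : T' ≤ T) :
    T' = T := by
  obtain ⟨r, hr⟩ := hT
  obtain ⟨r', hr'⟩ := hT'
  obtain ⟨R, hR, -⟩ := hr ((max r r' + 1 - r : ℝ) : ℂ)
    (by rw [Complex.ofReal_re]; linarith [le_max_left r r'])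
  obtain ⟨R', hR', -⟩ := hr' ((max r r' + 1 - r' : ℝ) : ℂ)
    (by rw [Complex.ofReal_re]; linarith [le_max_right r r'])
  have e1 : ((r : ℂ) + ((max r r' + 1 - r : ℝ) : ℂ)) = ((max r r' + 1 : ℝ) : ℂ) := by
    push_cast; ring
  have e2 : ((r' : ℂ) + ((max r r' + 1 - r' : ℝ) : ℂ)) = ((max r r' + 1 : ℝ) : ℂ) := by
    push_cast; ring
  rw [e1] at hR
  rw [e2] at hR'
  refine LinearPMap.eq_of_le_of_domain_eq h (le_antisymm h.1 fun x hx => ?_)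
  obtain ⟨hy, hy'⟩ := hR'.1 (T ⟨x, hx⟩ - (-((max r r' + 1 : ℝ) : ℂ)) • x)
  set y := R' (T ⟨x, hx⟩ - (-((max r r' + 1 : ℝ) : ℂ)) • x) with hydef
  have h1 : T' ⟨y, hy⟩ = T ⟨y, h.1 hy⟩ := h.2 rfl
  rw [h1] at hy'
  have h2 := hR.2 ⟨y, h.1 hy⟩
  have h3 := hR.2 ⟨x, hx⟩
  have h4 : y = x := by
    exact (h2.symm.trans (congrArg R hy')).trans h3
  exact h4 ▸ hy

/-! ### Operators between spaces of square-integrable functions -/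

section LpOperators

open scoped ENNReal

variable {X Y : Type*} [MeasurableSpace X] [MeasurableSpace Y]

theorem exists_clm_of_eLpNorm_le {μ : Measure X} {σ : Measure Y} (Φ : Lp ℂ 2 μ → Y → ℂ) {C : ℝ≥0∞}
    (hC : C ≠ ⊤) (hmeas : ∀ u, AEStronglyMeasurable (Φ u) σ)
    (hbound : ∀ u, eLpNorm (Φ u) 2 σ ≤ C * eLpNorm u 2 μ)
    (hadd : ∀ u v, Φ (u + v) =ᵐ[σ] fun y => Φ u y + Φ v y)
    (hsmul : ∀ (k : ℂ) u, Φ (k • u) =ᵐ[σ] fun y => k * Φ u y) :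
    ∃ T : Lp ℂ 2 μ →L[ℂ] Lp ℂ 2 σ, (∀ u, T u =ᵐ[σ] Φ u) ∧ ∀ u, ‖T u‖ ≤ C.toReal * ‖u‖ := by
  have hmem (u : Lp ℂ 2 μ) : MemLp (Φ u) 2 σ :=
    ⟨hmeas u, (hbound u).trans_lt (ENNReal.mul_lt_top hC.lt_top (Lp.memLp u).2)⟩
  let T₀ : Lp ℂ 2 μ →ₗ[ℂ] Lp ℂ 2 σ :=
    { toFun := fun u => (hmem u).toLp
      map_add' := fun u v => by
        ext1
        filter_upwards [(hmem (u + v)).coeFn_toLp, (hmem u).coeFn_toLp, (hmem v).coeFn_toLp,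
          Lp.coeFn_add (hmem u).toLp (hmem v).toLp, hadd u v] with y h1 h2 h3 h4 h5
        rw [h1, h4, h5, Pi.add_apply, h2, h3]
      map_smul' := fun k u => by
        ext1
        filter_upwards [(hmem (k • u)).coeFn_toLp, (hmem u).coeFn_toLp,
          Lp.coeFn_smul k (hmem u).toLp, hsmul k u] with y h1 h2 h3 h4
        rw [h1, h4, RingHom.id_apply, h3, Pi.smul_apply, h2, smul_eq_mul] }
  have hT₀ (u : Lp ℂ 2 μ) : ‖T₀ u‖ ≤ C.toReal * ‖u‖ := by
    change ‖(hmem u).toLp‖ ≤ _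
    rw [Lp.norm_toLp, Lp.norm_def, ← ENNReal.toReal_mul]
    exact ENNReal.toReal_mono (ENNReal.mul_lt_top hC.lt_top (Lp.memLp u).2).ne (hbound u)
  exact ⟨T₀.mkContinuous _ hT₀, fun u => (hmem u).coeFn_toLp, hT₀⟩

/-- Multiplication by an essentially bounded function is bounded on `L²`. -/
theorem exists_mul_clm {μ : Measure X} {m : X → ℂ} (hm : MemLp m ⊤ μ) :
    ∃ M : Lp ℂ 2 μ →L[ℂ] Lp ℂ 2 μ, ∀ u, M u =ᵐ[μ] fun x => m x * u x := by
  refine ⟨(ContinuousLinearMap.mul ℂ ℂ).holderL μ ⊤ 2 2 hm.toLp, fun u => ?_⟩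
  have h := (ContinuousLinearMap.mul ℂ ℂ).coeFn_holder (r := 2) hm.toLp u
  filter_upwards [h, hm.coeFn_toLp] with x h1 h2
  rw [← h2]
  exact h1

/-- Restriction from `L²(μ)` to `L²(μ')` if `μ' ≤ C μ`. -/
theorem exists_restrict_clm {μ μ' : Measure X} {C : ℝ≥0∞} (hC : C ≠ ⊤) (h : μ' ≤ C • μ) :
    ∃ I : Lp ℂ 2 μ →L[ℂ] Lp ℂ 2 μ', ∀ u, I u =ᵐ[μ'] u := by
  have hac : μ' ≪ μ := Measure.absolutelyContinuous_of_le_smul h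
  obtain ⟨I, hI, -⟩ := exists_clm_of_eLpNorm_le (μ := μ) (σ := μ') (fun u => u)
    (C := C ^ (1 / (2 : ℝ≥0∞).toReal)) (ENNReal.rpow_ne_top_of_nonneg (by positivity) hC)
    (fun u => (Lp.aestronglyMeasurable u).mono_ac hac)
    (fun u => by
      refine (eLpNorm_mono_measure _ h).trans ?_
      rw [eLpNorm_smul_measure_of_ne_top (by simp), smul_eq_mul]
      simp)
    (fun u v => hac.ae_le (Lp.coeFn_add u v))
    (fun k u => hac.ae_le (Lp.coeFn_smul k u))
  exact ⟨I, hI⟩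

section Kernel

variable {σ : Measure X} {ρ : Measure Y} [SFinite ρ]

theorem aestronglyMeasurable_integral_section {p : Y → ℝ} {F : X × Y → ℂ} (hp : MemLp p 2 ρ)
    (hF : AEStronglyMeasurable F (σ.prod ρ)) :
    AEStronglyMeasurable (fun x => ∫ y, p y • F (x, y) ∂ρ) σ :=
  AEStronglyMeasurable.integral_prod_right' (f := fun z : X × Y => p z.2 • F z)
    (hp.1.comp_snd.smul hF)

theorem ae_memLp_section {F : X × Y → ℂ} (hF : MemLp F 2 (σ.prod ρ)) :
    ∀ᵐ x ∂σ, MemLp (fun y => F (x, y)) 2 ρ := by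
  have h2 : ∫⁻ z, ‖F z‖ₑ ^ (2 : ℝ) ∂(σ.prod ρ) < ⊤ := by
    have := lintegral_rpow_enorm_lt_top_of_eLpNorm_lt_top (by simp) (by simp) hF.2
    simpa using this
  have hm : AEMeasurable (fun z => ‖F z‖ₑ ^ (2 : ℝ)) (σ.prod ρ) := hF.1.enorm.pow_const _
  rw [lintegral_prod _ hm] at h2
  filter_upwards [ae_lt_top' hm.lintegral_prod_right' h2.ne, hF.1.prodMk_left] with x h3 h4
  refine ⟨h4, ?_⟩
  rw [eLpNorm_lt_top_iff_lintegral_rpow_enorm_lt_top (by simp) (by simp)]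
  simpa using h3

theorem eLpNorm_integral_section_le [SFinite σ] {p : Y → ℝ} {F : X × Y → ℂ} (hp : MemLp p 2 ρ)
    (hF : MemLp F 2 (σ.prod ρ)) :
    eLpNorm (fun x => ∫ y, p y • F (x, y) ∂ρ) 2 σ ≤
      eLpNorm p 2 ρ * eLpNorm F 2 (σ.prod ρ) := by
  have hm : AEMeasurable (fun z => ‖F z‖ₑ ^ (2 : ℝ)) (σ.prod ρ) := hF.1.enorm.pow_const _
  have key : ∀ᵐ x ∂σ, ‖∫ y, p y • F (x, y) ∂ρ‖ₑ ^ (2 : ℝ) ≤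
      eLpNorm p 2 ρ ^ (2 : ℝ) * ∫⁻ y, ‖F (x, y)‖ₑ ^ (2 : ℝ) ∂ρ := by
    filter_upwards [ae_memLp_section hF] with x hx
    have h1 : ‖∫ y, p y • F (x, y) ∂ρ‖ₑ ≤ eLpNorm p 2 ρ * eLpNorm (fun y => F (x, y)) 2 ρ := by
      refine (enorm_integral_le_lintegral_enorm _).trans ?_
      rw [← eLpNorm_one_eq_lintegral_enorm]
      exact eLpNorm_smul_le_mul_eLpNorm (p := 2) (q := 2) (r := 1) (f := fun y => F (x, y))
        (φ := p) hx.1 hp.1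
    refine (ENNReal.rpow_le_rpow h1 (by norm_num)).trans ?_
    rw [ENNReal.mul_rpow_of_nonneg _ _ (by norm_num)]
    refine mul_le_mul_right (le_of_eq ?_) _
    rw [eLpNorm_eq_lintegral_rpow_enorm_toReal (by simp) (by simp), ← ENNReal.rpow_mul]
    simp
  rw [eLpNorm_eq_lintegral_rpow_enorm_toReal (by simp) (by simp),
    eLpNorm_eq_lintegral_rpow_enorm_toReal (f := F) (by simp) (by simp)]
  simp only [ENNReal.toReal_ofNat]
  calc _ ≤ (∫⁻ x, eLpNorm p 2 ρ ^ (2 : ℝ) * ∫⁻ y, ‖F (x, y)‖ₑ ^ (2 : ℝ) ∂ρ ∂σ) ^ (1 / (2 : ℝ)) :=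
        ENNReal.rpow_le_rpow (lintegral_mono_ae key) (by norm_num)
    _ = _ := by
        rw [lintegral_const_mul'' _ hm.lintegral_prod_right', ← lintegral_prod _ hm,
          ENNReal.mul_rpow_of_nonneg _ _ (by norm_num), ← ENNReal.rpow_mul]
        norm_num

/-- Integration of the sections of a square-integrable function against a square-integrable weight
is bounded into `L²`, with the `L²` norm of the weight as a bound. -/
theorem exists_kernel_clm [SFinite σ] {p : Y → ℝ} (hp : MemLp p 2 ρ) :
    ∃ K : Lp ℂ 2 (σ.prod ρ) →L[ℂ] Lp ℂ 2 σ,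
      (∀ u, K u =ᵐ[σ] fun x => ∫ y, p y • u (x, y) ∂ρ) ∧
        ∀ u, ‖K u‖ ≤ (eLpNorm p 2 ρ).toReal * ‖u‖ := by
  have hint (u : Lp ℂ 2 (σ.prod ρ)) : ∀ᵐ x ∂σ, Integrable (fun y => p y • u (x, y)) ρ := by
    filter_upwards [ae_memLp_section (Lp.memLp u)] with x hx
    exact memLp_one_iff_integrable.1 (hx.smul hp)
  refine exists_clm_of_eLpNorm_le (fun u x => ∫ y, p y • u (x, y) ∂ρ) hp.2.ne
    (fun u => aestronglyMeasurable_integral_section hp (Lp.aestronglyMeasurable u))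
    (fun u => eLpNorm_integral_section_le hp (Lp.memLp u)) (fun u v => ?_) (fun k u => ?_)
  · filter_upwards [hint u, hint v, Measure.ae_ae_of_ae_prod (Lp.coeFn_add u v)] with x h1 h2 h3
    rw [← integral_add h1 h2]
    refine integral_congr_ae ?_
    filter_upwards [h3] with y hy
    rw [hy, Pi.add_apply, smul_add]
  · filter_upwards [Measure.ae_ae_of_ae_prod (Lp.coeFn_smul k u)] with x h3
    rw [← integral_const_mul]
    refine integral_congr_ae ?_
    filter_upwards [h3] with y hy
    rw [hy, Pi.smul_apply, smul_eq_mul, mul_smul_comm]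

end Kernel

theorem exists_pairing_clm {ν : Measure X} {w : X → ℝ} (hw : MemLp w 2 ν) :
    ∃ L : Lp ℂ 2 ν →L[ℂ] ℂ, ∀ u, L u = ∫ x, w x • u x ∂ν := by
  have hw' : MemLp (fun x => (w x : ℂ)) 2 ν := hw.ofReal
  refine ⟨innerSL ℂ hw'.toLp, fun u => ?_⟩
  rw [innerSL_apply_apply, L2.inner_def]
  refine integral_congr_ae ?_
  filter_upwards [hw'.coeFn_toLp] with x hx
  rw [hx]
  simp [mul_comm]

end LpOperators

/-! ### The Riemannian measure -/

section RiemannianMeasure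

variable {l a : ℝ} {f : ℝ × ℝ → ℝ}

/-- Lebesgue measure on the rectangle. -/
noncomputable abbrev lebRect (l a : ℝ) : Measure (ℝ × ℝ) := volume.restrict (rect l a)

theorem lebRect_eq_prod (l a : ℝ) :
    lebRect l a = (volume.restrict (Ioo (-l) l)).prod (volume.restrict (Ioo (-a) a)) := by
  rw [lebRect, rect, Measure.volume_eq_prod, Measure.prod_restrict]

instance isFiniteMeasure_lebRect (l a : ℝ) : IsFiniteMeasure (lebRect l a) := by
  rw [lebRect_eq_prod]; infer_instance

theorem exists_ae_bounds (hf_pos : ∀ᵐ x ∂(lebRect l a), 0 < f x) (hf : MemLp f ⊤ (lebRect l a))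
    (hf_inv : MemLp (fun x => (f x)⁻¹) ⊤ (lebRect l a)) :
    ∃ C : ℝ, 0 < C ∧ ∀ᵐ x ∂(lebRect l a), C⁻¹ ≤ f x ∧ f x ≤ C := by
  set C₁ := (eLpNorm f ⊤ (lebRect l a)).toReal
  set C₂ := (eLpNorm (fun x => (f x)⁻¹) ⊤ (lebRect l a)).toReal
  have h1 : ∀ᵐ x ∂(lebRect l a), ‖f x‖ ≤ C₁ := by
    filter_upwards [ae_le_eLpNormEssSup (f := f) (μ := lebRect l a)] with x hx
    rw [← eLpNorm_exponent_top] at hx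
    exact (toReal_enorm (f x)).symm.le.trans (ENNReal.toReal_mono hf.2.ne hx)
  have h2 : ∀ᵐ x ∂(lebRect l a), ‖(f x)⁻¹‖ ≤ C₂ := by
    filter_upwards [ae_le_eLpNormEssSup (f := fun x => (f x)⁻¹) (μ := lebRect l a)] with x hx
    rw [← eLpNorm_exponent_top] at hx
    exact (toReal_enorm (f x)⁻¹).symm.le.trans (ENNReal.toReal_mono hf_inv.2.ne hx)
  refine ⟨max C₁ C₂ + 1, by positivity, ?_⟩
  filter_upwards [h1, h2, hf_pos] with x h3 h4 h5
  rw [Real.norm_of_nonneg h5.le] at h3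
  rw [Real.norm_of_nonneg (inv_pos.2 h5).le] at h4
  refine ⟨?_, by linarith [le_max_left C₁ C₂]⟩
  rw [inv_le_comm₀ (by positivity) h5]
  linarith [le_max_right C₁ C₂]

theorem muG_le {C : ℝ} (hC : ∀ᵐ x ∂(lebRect l a), C⁻¹ ≤ f x ∧ f x ≤ C) :
    muG l a f ≤ ENNReal.ofReal C • lebRect l a := by
  rw [muG, ← withDensity_const]
  exact withDensity_mono (hC.mono fun x hx => ENNReal.ofReal_le_ofReal hx.2)

theorem le_muG {C : ℝ} (hC0 : 0 < C) (hC : ∀ᵐ x ∂(lebRect l a), C⁻¹ ≤ f x ∧ f x ≤ C) :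
    lebRect l a ≤ ENNReal.ofReal C • muG l a f := by
  have h : ENNReal.ofReal C⁻¹ • lebRect l a ≤ muG l a f := by
    rw [muG, ← withDensity_const]
    exact withDensity_mono (hC.mono fun x hx => ENNReal.ofReal_le_ofReal hx.1)
  intro s
  have h1 := mul_le_mul_right (h s) (ENNReal.ofReal C)
  simp only [Measure.smul_apply, smul_eq_mul] at h1 ⊢
  rwa [← mul_assoc, ← ENNReal.ofReal_mul hC0.le, mul_inv_cancel₀ hC0.ne', ENNReal.ofReal_one,
    one_mul] at h1

theorem ae_muG_eq {C : ℝ} (hC0 : 0 < C) (hC : ∀ᵐ x ∂(lebRect l a), C⁻¹ ≤ f x ∧ f x ≤ C) :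
    ae (muG l a f) = ae (lebRect l a) :=
  le_antisymm (Measure.absolutelyContinuous_of_le_smul (muG_le hC)).ae_le
    (Measure.absolutelyContinuous_of_le_smul (le_muG hC0 hC)).ae_le

theorem memLp_muG_iff {C : ℝ} (hC0 : 0 < C) (hC : ∀ᵐ x ∂(lebRect l a), C⁻¹ ≤ f x ∧ f x ≤ C)
    {g : ℝ × ℝ → ℂ} : MemLp g 2 (muG l a f) ↔ MemLp g 2 (lebRect l a) :=
  ⟨fun h => h.of_measure_le_smul ENNReal.ofReal_ne_top (le_muG hC0 hC),
    fun h => h.of_measure_le_smul ENNReal.ofReal_ne_top (muG_le hC)⟩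

end RiemannianMeasure

/-! ### Weak derivatives tested with functions that vanish on two sides -/

section Cutoff

/-- The factor `|t + 1|` is what appears when the argument is `n (c² - y²) - 1`, see `cutoff`. -/
theorem exists_bound_deriv_smoothTransition :
    ∃ C : ℝ, 0 ≤ C ∧ ∀ t, |t + 1| * |deriv Real.smoothTransition t| ≤ C := by
  have hcont : Continuous (deriv Real.smoothTransition) :=
    (Real.smoothTransition.contDiff (n := 1)).continuous_deriv le_rfl
  obtain ⟨C, hC⟩ := (isCompact_Icc (a := (0 : ℝ)) (b := 1)).exists_bound_of_continuousOn
    (f := fun t => |t + 1| * |deriv Real.smoothTransition t|) (by fun_prop)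
  have hC' : ∀ t ∈ Icc (0 : ℝ) 1, |t + 1| * |deriv Real.smoothTransition t| ≤ C := fun t ht =>
    (le_abs_self _).trans (hC t ht)
  have hC0 : 0 ≤ C := le_trans (by positivity) (hC' 0 (by simp))
  refine ⟨C, hC0, fun t => ?_⟩
  rcases lt_or_ge t 0 with h | h
  · have : deriv Real.smoothTransition t = 0 := by
      have : Real.smoothTransition =ᶠ[𝓝 t] fun _ => 0 := by
        filter_upwards [Iio_mem_nhds h] with s hs
        exact Real.smoothTransition.zero_of_nonpos (le_of_lt hs)
      rw [this.deriv_eq, deriv_const]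
    simpa [this] using hC0
  · rcases lt_or_ge 1 t with h1 | h1
    · have : deriv Real.smoothTransition t = 0 := by
        have : Real.smoothTransition =ᶠ[𝓝 t] fun _ => 1 := by
          filter_upwards [Ioi_mem_nhds h1] with s hs
          exact Real.smoothTransition.one_of_one_le (le_of_lt hs)
        rw [this.deriv_eq, deriv_const]
      simpa [this] using hC0
    · exact hC' t ⟨h, h1⟩

/-- Smooth cut-off functions on `(-c, c)`, which increase to `1` as `n → ∞`. -/
noncomputable def cutoff (c : ℝ) (n : ℕ) (y : ℝ) : ℝ :=
  Real.smoothTransition ((n : ℝ) * (c ^ 2 - y ^ 2) - 1)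

theorem contDiff_cutoff (c : ℝ) (n : ℕ) : ContDiff ℝ ∞ (cutoff c n) :=
  Real.smoothTransition.contDiff.comp (by fun_prop)

theorem abs_cutoff_le (c : ℝ) (n : ℕ) (y : ℝ) : |cutoff c n y| ≤ 1 := by
  rw [cutoff, abs_of_nonneg (Real.smoothTransition.nonneg ((n : ℝ) * (c ^ 2 - y ^ 2) - 1))]
  exact Real.smoothTransition.le_one _

theorem one_le_of_cutoff_ne_zero {c : ℝ} {n : ℕ} {y : ℝ} (h : cutoff c n y ≠ 0) :
    1 ≤ (n : ℝ) * (c ^ 2 - y ^ 2) := by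
  by_contra! h1
  exact h (Real.smoothTransition.zero_of_nonpos (by linarith))

theorem eventually_cutoff_eq_one {c y : ℝ} (hy : y ∈ Ioo (-c) c) :
    ∀ᶠ n : ℕ in atTop, ∀ᶠ z in 𝓝 y, cutoff c n z = 1 := by
  have h0 : 0 < c ^ 2 - y ^ 2 := by nlinarith [hy.1, hy.2]
  have h1 : ∀ᶠ n : ℕ in atTop, 2 < (n : ℝ) * (c ^ 2 - y ^ 2) :=
    (tendsto_natCast_atTop_atTop.atTop_mul_const h0).eventually_gt_atTop 2
  filter_upwards [h1] with n hn
  have hc : Continuous fun z : ℝ => (n : ℝ) * (c ^ 2 - z ^ 2) := by fun_prop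
  filter_upwards [hc.continuousAt.eventually (lt_mem_nhds hn)] with z hz
  exact Real.smoothTransition.one_of_one_le (by linarith)

/-- The derivatives of the cut-off functions grow only like the inverse distance to `±c`. -/
theorem exists_bound_deriv_cutoff {c : ℝ} (hc : 0 < c) :
    ∃ C : ℝ, 0 ≤ C ∧ ∀ (n : ℕ) (y : ℝ), y ∈ Ioo (-c) c →
      (c ^ 2 - y ^ 2) * |deriv (cutoff c n) y| ≤ C := by
  obtain ⟨C, hC0, hC⟩ := exists_bound_deriv_smoothTransition
  refine ⟨C * (2 * c), by positivity, fun n y hy => ?_⟩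
  have h0 : 0 < c ^ 2 - y ^ 2 := by nlinarith [hy.1, hy.2]
  have hd : HasDerivAt (fun y : ℝ => (n : ℝ) * (c ^ 2 - y ^ 2) - 1) ((n : ℝ) * (-(2 * y))) y := by
    have := (((hasDerivAt_pow 2 y).const_sub (c ^ 2)).const_mul (n : ℝ)).sub_const 1
    simpa using this
  have hS : DifferentiableAt ℝ Real.smoothTransition ((n : ℝ) * (c ^ 2 - y ^ 2) - 1) :=
    (Real.smoothTransition.contDiff (n := 1)).differentiable (by simp) _
  have h1 : deriv (cutoff c n) y = deriv Real.smoothTransition ((n : ℝ) * (c ^ 2 - y ^ 2) - 1) *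
      ((n : ℝ) * (-(2 * y))) := (hS.hasDerivAt.comp y hd).deriv
  have h2 := hC ((n : ℝ) * (c ^ 2 - y ^ 2) - 1)
  rw [sub_add_cancel, abs_of_nonneg (by positivity)] at h2
  have h3 : |y| ≤ c := abs_le.2 ⟨hy.1.le, hy.2.le⟩
  rw [h1, abs_mul, abs_mul, abs_neg, abs_mul, abs_two, Nat.abs_cast]
  calc _ = ((n : ℝ) * (c ^ 2 - y ^ 2) *
        |deriv Real.smoothTransition ((n : ℝ) * (c ^ 2 - y ^ 2) - 1)|) * (2 * |y|) := by ring
    _ ≤ _ := by gcongr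

end Cutoff

section Green

variable {l a : ℝ} {u g : ℝ × ℝ → ℂ}

theorem rect_subset_Icc (l a : ℝ) : rect l a ⊆ Icc (-l) l ×ˢ Icc (-a) a :=
  prod_mono Ioo_subset_Icc_self Ioo_subset_Icc_self

theorem measurableSet_rect (l a : ℝ) : MeasurableSet (rect l a) :=
  measurableSet_Ioo.prod measurableSet_Ioo

theorem isOpen_rect (l a : ℝ) : IsOpen (rect l a) := isOpen_Ioo.prod isOpen_Ioo

theorem exists_bound_on_rect (l a : ℝ) {w : ℝ × ℝ → ℝ} (hw : Continuous w) :
    ∃ C : ℝ, 0 ≤ C ∧ ∀ z ∈ Icc (-l) l ×ˢ Icc (-a) a, |w z| ≤ C := by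
  obtain ⟨C, hC⟩ := (isCompact_Icc.prod isCompact_Icc).exists_bound_of_continuousOn
    (s := Icc (-l) l ×ˢ Icc (-a) a) hw.continuousOn
  exact ⟨|C|, abs_nonneg C, fun z hz => (hC z hz).trans (le_abs_self C)⟩

theorem memLp_lebRect_of_continuous (l a : ℝ) {w : ℝ × ℝ → ℝ} (hw : Continuous w) (p : ENNReal) :
    MemLp w p (lebRect l a) := by
  obtain ⟨C, -, hC⟩ := exists_bound_on_rect l a hw
  refine MemLp.of_bound hw.aestronglyMeasurable C ?_
  filter_upwards [ae_restrict_mem (measurableSet_rect l a)] with z hz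
  exact hC z (rect_subset_Icc l a hz)

theorem memLp_Ioo_of_continuous (c : ℝ) {w : ℝ → ℝ} (hw : Continuous w) (p : ENNReal) :
    MemLp w p (volume.restrict (Ioo (-c) c)) := by
  obtain ⟨C, hC⟩ := (isCompact_Icc (a := -c) (b := c)).exists_bound_of_continuousOn
    hw.continuousOn
  refine MemLp.of_bound hw.aestronglyMeasurable C ?_
  filter_upwards [ae_restrict_mem measurableSet_Ioo] with z hz
  exact hC z (Ioo_subset_Icc_self hz)

theorem integrable_smul_lebRect {w : ℝ × ℝ → ℝ} (hw : Continuous w) (hu : MemLp u 2 (lebRect l a)) :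
    Integrable (fun z => w z • u z) (lebRect l a) :=
  memLp_one_iff_integrable.1 (hu.smul (memLp_lebRect_of_continuous l a hw 2))

theorem continuous_fderiv_apply {η : ℝ × ℝ → ℝ} (hη : ContDiff ℝ ∞ η) (e : ℝ × ℝ) :
    Continuous fun z => fderiv ℝ η z e :=
  (hη.continuous_fderiv (by simp)).clm_apply continuous_const

theorem hasDerivAt_snd {η : ℝ × ℝ → ℝ} (hη : ContDiff ℝ ∞ η) (z : ℝ × ℝ) :
    HasDerivAt (fun y => η (z.1, y)) (fderiv ℝ η z (0, 1)) z.2 :=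
  (hη.differentiable (by simp) z).hasFDerivAt.comp_hasDerivAt (f := fun y => (z.1, y)) z.2
    ((hasDerivAt_const z.2 z.1).prodMk (hasDerivAt_id z.2))

/-- The definition of the weak derivative `∂₂` extends from compactly supported test functions to
those that vanish on the two sides `x₂ = ±a`: cutting off costs only a bounded factor, because the
growth of the derivative of the cut-off is compensated by the zero of `ζ`. -/
theorem weak_green_of_vanishing (hl : 0 < l) (ha : 0 < a) (hu : MemLp u 2 (lebRect l a))
    (hw : IsWeakPartial (rect l a) (0, 1) u g) {ζ : ℝ × ℝ → ℝ} (hζ : ContDiff ℝ ∞ ζ)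
    (htop : ∀ x, ζ (x, a) = 0) (hbot : ∀ x, ζ (x, -a) = 0) :
    ∫ z in rect l a, (fderiv ℝ ζ z (0, 1) • u z + ζ z • g z) = 0 := by
  obtain ⟨hg, hw⟩ := hw
  let ζ' : ℝ × ℝ → ℝ := fun z => fderiv ℝ ζ z (0, 1)
  have hζ' : Continuous ζ' := continuous_fderiv_apply hζ _
  obtain ⟨M, hM0, hM⟩ := exists_bound_on_rect l a hζ'
  obtain ⟨N, hN0, hN⟩ := exists_bound_on_rect l a hζ.continuous
  obtain ⟨C, hC0, hC⟩ := exists_bound_deriv_cutoff ha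
  -- `ζ` vanishes to first order at `x₂ = ±a`
  have hvan : ∀ z ∈ rect l a, |ζ z| ≤ M / a * (a ^ 2 - z.2 ^ 2) := by
    intro z hz
    have hmv (s : ℝ) (hs : s ∈ Icc (-a) a) (h0 : ζ (z.1, s) = 0) : |ζ z| ≤ M * |z.2 - s| := by
      have h1 := (convex_Icc (-a) a).norm_image_sub_le_of_norm_hasDerivWithin_le
        (f := fun y => ζ (z.1, y)) (f' := fun y => ζ' (z.1, y)) (C := M) (x := s) (y := z.2)
        (fun y _ => (hasDerivAt_snd hζ (z.1, y)).hasDerivWithinAt)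
        (fun y hy => hM _ ⟨Ioo_subset_Icc_self hz.1, hy⟩) hs (Ioo_subset_Icc_self hz.2)
      simpa [h0] using h1
    have h1 := hmv a ⟨by linarith, le_rfl⟩ (htop _)
    have h2 := hmv (-a) ⟨le_rfl, by linarith⟩ (hbot _)
    have h3 := hz.2.1
    have h4 := hz.2.2
    rw [abs_sub_comm, abs_of_pos (show 0 < a - z.2 by linarith)] at h1
    rw [abs_of_pos (show 0 < z.2 - -a by linarith)] at h2
    rw [div_mul_eq_mul_div, le_div_iff₀ ha]
    rcases le_total 0 z.2 with h | h
    · have h5 : 0 ≤ M * (a - z.2) := mul_nonneg hM0 (by linarith)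
      calc |ζ z| * a ≤ M * (a - z.2) * (a + z.2) :=
            mul_le_mul h1 (by linarith) ha.le h5
        _ = _ := by ring
    · have h5 : 0 ≤ M * (z.2 - -a) := mul_nonneg hM0 (by linarith)
      calc |ζ z| * a ≤ M * (z.2 - -a) * (a - z.2) :=
            mul_le_mul h2 (by linarith) ha.le h5
        _ = _ := by ring
  -- the cut-off in `x₁` is not differentiated, so it needs no bound on its derivative
  let η : ℕ → ℝ × ℝ → ℝ := fun n z => cutoff l n z.1 * (cutoff a n z.2 * ζ z)
  have hη (n : ℕ) : ContDiff ℝ ∞ (η n) :=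
    ((contDiff_cutoff l n).comp contDiff_fst).mul
      (((contDiff_cutoff a n).comp contDiff_snd).mul hζ)
  have hη' (n : ℕ) (z : ℝ × ℝ) : fderiv ℝ (η n) z (0, 1) =
      cutoff l n z.1 * (deriv (cutoff a n) z.2 * ζ z + cutoff a n z.2 * ζ' z) := by
    have hcd : DifferentiableAt ℝ (cutoff a n) z.2 :=
      (contDiff_cutoff a n).differentiable (by simp) _
    have h1 := (hcd.hasDerivAt.mul (hasDerivAt_snd hζ z)).const_mul (cutoff l n z.1)
    exact (hasDerivAt_snd (hη n) z).unique h1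
  have hsupp (n : ℕ) : tsupport (η n) ⊆
      {z | 1 ≤ (n : ℝ) * (l ^ 2 - z.1 ^ 2)} ∩ {z | 1 ≤ (n : ℝ) * (a ^ 2 - z.2 ^ 2)} := by
    refine closure_minimal (fun z hz => ?_) ((isClosed_le (by fun_prop) (by fun_prop)).inter
      (isClosed_le (by fun_prop) (by fun_prop)))
    have h1 : cutoff l n z.1 ≠ 0 := left_ne_zero_of_mul hz
    have h2 : cutoff a n z.2 ≠ 0 := left_ne_zero_of_mul (right_ne_zero_of_mul hz)
    exact ⟨one_le_of_cutoff_ne_zero h1, one_le_of_cutoff_ne_zero h2⟩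
  have hmem {c t : ℝ} (hc : 0 < c) {n : ℕ} (h : 1 ≤ (n : ℝ) * (c ^ 2 - t ^ 2)) :
      t ∈ Ioo (-c) c := by
    have h1 : 0 < c ^ 2 - t ^ 2 := by
      by_contra! h2
      linarith [mul_nonpos_of_nonneg_of_nonpos (Nat.cast_nonneg (α := ℝ) n) h2]
    exact abs_lt.1 (abs_lt_of_sq_lt_sq (by linarith) hc.le)
  have hsupp' (n : ℕ) : tsupport (η n) ⊆ rect l a := fun z hz =>
    ⟨hmem hl (hsupp n hz).1, hmem ha (hsupp n hz).2⟩
  have hcomp (n : ℕ) : HasCompactSupport (η n) :=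
    (isCompact_Icc.prod isCompact_Icc).of_isClosed_subset (isClosed_tsupport _)
      ((hsupp' n).trans (rect_subset_Icc l a))
  have hlim : ∀ z ∈ rect l a, ∀ᶠ n in atTop, η n z = ζ z ∧ fderiv ℝ (η n) z (0, 1) = ζ' z := by
    intro z hz
    filter_upwards [eventually_cutoff_eq_one hz.1, eventually_cutoff_eq_one hz.2] with n h1 h2
    have h3 : deriv (cutoff a n) z.2 = 0 := by
      have h4 : cutoff a n =ᶠ[𝓝 z.2] fun _ => 1 := h2
      rw [h4.deriv_eq, deriv_const]
    refine ⟨?_, ?_⟩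
    · simp only [η, h1.self_of_nhds, h2.self_of_nhds, one_mul]
    · rw [hη', h1.self_of_nhds, h2.self_of_nhds, h3]; ring
  have hui : Integrable u (lebRect l a) := hu.integrable (by norm_num)
  have hgi : Integrable g (lebRect l a) := hg.integrable (by norm_num)
  have lim1 : Tendsto (fun n => ∫ z in rect l a, fderiv ℝ (η n) z (0, 1) • u z) atTop
      (𝓝 (∫ z in rect l a, ζ' z • u z)) := by
    refine tendsto_integral_of_dominated_convergence (fun z => (M / a * C + M) * ‖u z‖)
      (fun n => (continuous_fderiv_apply (hη n) _).aestronglyMeasurable.smul hu.1)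
      (hui.norm.const_mul _) (fun n => ?_) ?_
    · filter_upwards [ae_restrict_mem (measurableSet_rect l a)] with z hz
      rw [norm_smul, hη', Real.norm_eq_abs, abs_mul]
      have h1 : |deriv (cutoff a n) z.2 * ζ z| ≤ M / a * C := by
        rw [abs_mul]
        calc _ ≤ |deriv (cutoff a n) z.2| * (M / a * (a ^ 2 - z.2 ^ 2)) := by
              gcongr; exact hvan z hz
          _ = M / a * ((a ^ 2 - z.2 ^ 2) * |deriv (cutoff a n) z.2|) := by ring
          _ ≤ _ := by gcongr; exact hC n _ hz.2
      have h2 : |cutoff a n z.2 * ζ' z| ≤ M := by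
        rw [abs_mul]
        calc _ ≤ 1 * M := by
              gcongr
              · exact abs_cutoff_le _ _ _
              · exact hM z (rect_subset_Icc l a hz)
          _ = M := one_mul M
      have h3 := (abs_add_le (deriv (cutoff a n) z.2 * ζ z) (cutoff a n z.2 * ζ' z)).trans
        (add_le_add h1 h2)
      gcongr
      calc _ ≤ 1 * (M / a * C + M) := by
            gcongr
            exact abs_cutoff_le _ _ _
        _ = _ := one_mul _
    · filter_upwards [ae_restrict_mem (measurableSet_rect l a)] with z hz
      refine tendsto_const_nhds.congr' ?_
      filter_upwards [hlim z hz] with n hn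
      rw [hn.2]
  have lim2 : Tendsto (fun n => ∫ z in rect l a, η n z • g z) atTop
      (𝓝 (∫ z in rect l a, ζ z • g z)) := by
    refine tendsto_integral_of_dominated_convergence (fun z => N * ‖g z‖)
      (fun n => (hη n).continuous.aestronglyMeasurable.smul hg.1)
      (hgi.norm.const_mul _) (fun n => ?_) ?_
    · filter_upwards [ae_restrict_mem (measurableSet_rect l a)] with z hz
      rw [norm_smul, Real.norm_eq_abs, abs_mul, abs_mul]
      gcongr
      calc _ ≤ 1 * (1 * N) := by
            gcongr
            · exact abs_cutoff_le _ _ _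
            · exact abs_cutoff_le _ _ _
            · exact hN z (rect_subset_Icc l a hz)
        _ = N := by ring
    · filter_upwards [ae_restrict_mem (measurableSet_rect l a)] with z hz
      refine tendsto_const_nhds.congr' ?_
      filter_upwards [hlim z hz] with n hn
      rw [hn.1]
  have h := tendsto_nhds_unique lim1
    (lim2.neg.congr fun n => (hw (η n) (hη n) (hcomp n) (hsupp' n)).symm)
  rw [integral_add (integrable_smul_lebRect hζ' hu) (integrable_smul_lebRect hζ.continuous hg), h,
    neg_add_cancel]

end Green
/-! ### Uniqueness of weak derivatives -/

section Uniqueness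

theorem ae_eq_of_integral_test_eq {E : Type*} [NormedAddCommGroup E] [NormedSpace ℝ E]
    [FiniteDimensional ℝ E] [MeasurableSpace E] [BorelSpace E] {μ : Measure E} {U : Set E}
    (hU : IsOpen U) {v w : E → ℂ} (hv : IntegrableOn v U μ) (hw : IntegrableOn w U μ)
    (h : ∀ η : E → ℝ, ContDiff ℝ ∞ η → HasCompactSupport η → tsupport η ⊆ U →
      ∫ x in U, η x • v x ∂μ = ∫ x in U, η x • w x ∂μ) :
    v =ᵐ[μ.restrict U] w := by
  have h0 := hU.ae_eq_zero_of_integral_contDiff_smul_eq_zero (hv.sub hw).locallyIntegrableOn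
    (fun η hη hc hs => by
      have h1 : ∫ x, η x • (v - w) x ∂μ = ∫ x in U, η x • (v - w) x ∂μ := by
        rw [setIntegral_eq_integral_of_forall_compl_eq_zero]
        intro x hx
        rw [image_eq_zero_of_notMem_tsupport fun h' => hx (hs h'), zero_smul]
      obtain ⟨C, hC⟩ := hη.continuous.bounded_above_of_compact_support hc
      have hi {f : E → ℂ} (hf : IntegrableOn f U μ) : IntegrableOn (fun x => η x • f x) U μ :=
        hf.bdd_smul C hη.continuous.aestronglyMeasurable (ae_of_all _ hC)
      rw [h1]
      simp only [Pi.sub_apply, smul_sub]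
      rw [integral_sub (hi hv) (hi hw), h η hη hc hs, sub_self])
  rw [EventuallyEq, ae_restrict_iff' hU.measurableSet]
  filter_upwards [h0] with x hx hxU
  exact sub_eq_zero.1 (hx hxU)

variable {l a : ℝ} {u g : ℝ × ℝ → ℂ}

theorem IsWeakPartial.weakPartial_spec {U : Set (ℝ × ℝ)} {e : ℝ × ℝ}
    (h : ∃ g, IsWeakPartial U e u g) : IsWeakPartial U e u (weakPartial U e u) := by
  rw [weakPartial, dif_pos h]; exact h.choose_spec

theorem IsWeakPartial.weakPartial_ae_eq {e : ℝ × ℝ} (h : IsWeakPartial (rect l a) e u g) :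
    weakPartial (rect l a) e u =ᵐ[lebRect l a] g := by
  have h' := IsWeakPartial.weakPartial_spec ⟨g, h⟩
  exact ae_eq_of_integral_test_eq (isOpen_rect l a) (h'.1.integrable (by norm_num))
    (h.1.integrable (by norm_num)) fun η h1 h2 h3 =>
      neg_injective ((h'.2 η h1 h2 h3).symm.trans (h.2 η h1 h2 h3))

theorem MemW12.isWeakPartial_d1 (h : MemW12 l a u) :
    IsWeakPartial (rect l a) (1, 0) u (d1 l a u) := IsWeakPartial.weakPartial_spec h.2.1

theorem MemW12.isWeakPartial_d2 (h : MemW12 l a u) :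
    IsWeakPartial (rect l a) (0, 1) u (d2 l a u) := IsWeakPartial.weakPartial_spec h.2.2

end Uniqueness

/-! ### Boundary traces -/

section Traces

variable {l a : ℝ} {u g : ℝ × ℝ → ℂ} {p q : ℝ → ℝ}

/-- The integral of `∂₂ (p u)` over vertical sections, where `g = ∂₂ u`. If the weight `p` is `1` at
one end of `(-a, a)` and `0` at the other one, it is up to sign the boundary value of `u` there. -/
noncomputable def sideValue (a : ℝ) (p : ℝ → ℝ) (u g : ℝ × ℝ → ℂ) (x : ℝ) : ℂ :=
  (∫ y in Ioo (-a) a, deriv p y • u (x, y)) + ∫ y in Ioo (-a) a, p y • g (x, y)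

theorem memLp_sideValue (hp : ContDiff ℝ ∞ p) (hu : MemLp u 2 (lebRect l a))
    (hg : MemLp g 2 (lebRect l a)) :
    MemLp (sideValue a p u g) 2 (volume.restrict (Ioo (-l) l)) := by
  have h {w : ℝ → ℝ} {v : ℝ × ℝ → ℂ} (hw : Continuous w) (hv : MemLp v 2 (lebRect l a)) :
      MemLp (fun x => ∫ y in Ioo (-a) a, w y • v (x, y)) 2 (volume.restrict (Ioo (-l) l)) := by
    rw [lebRect_eq_prod] at hv
    have hw2 := memLp_Ioo_of_continuous a hw 2
    exact ⟨aestronglyMeasurable_integral_section hw2 hv.1,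
      (eLpNorm_integral_section_le hw2 hv).trans_lt (ENNReal.mul_lt_top hw2.2 hv.2)⟩
  exact (h (hp.continuous_deriv (by simp)) hu).add (h hp.continuous hg)

theorem integral_smul_sideValue {χ : ℝ → ℝ} (hχ : Continuous χ) (hp : ContDiff ℝ ∞ p)
    (hu : MemLp u 2 (lebRect l a)) (hg : MemLp g 2 (lebRect l a)) :
    ∫ x in Ioo (-l) l, χ x • sideValue a p u g x =
      ∫ z in rect l a, ((χ z.1 * deriv p z.2) • u z + (χ z.1 * p z.2) • g z) := by
  have h {w : ℝ → ℝ} {v : ℝ × ℝ → ℂ} (hw : Continuous w) (hv : MemLp v 2 (lebRect l a)) :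
      Integrable (fun z : ℝ × ℝ => (χ z.1 * w z.2) • v z) (lebRect l a) ∧
      Integrable (fun x => χ x • ∫ y in Ioo (-a) a, w y • v (x, y))
          (volume.restrict (Ioo (-l) l)) ∧
        ∫ x in Ioo (-l) l, χ x • ∫ y in Ioo (-a) a, w y • v (x, y) =
          ∫ z in rect l a, (χ z.1 * w z.2) • v z := by
    have hi : Integrable (fun z : ℝ × ℝ => (χ z.1 * w z.2) • v z) (lebRect l a) :=
      integrable_smul_lebRect (w := fun z : ℝ × ℝ => χ z.1 * w z.2) (by fun_prop) hv
    have hi' := hi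
    rw [lebRect_eq_prod] at hi'
    have h1 := hi'.integral_prod_left
    have h2 := integral_prod _ hi'
    simp only [mul_smul, integral_smul] at h1 h2
    refine ⟨hi, h1, ?_⟩
    rw [← h2, ← lebRect_eq_prod]
    simp only [mul_smul]
  obtain ⟨h1, h2, h3⟩ := h (hp.continuous_deriv (by simp)) hu
  obtain ⟨h4, h5, h6⟩ := h hp.continuous hg
  simp only [sideValue, smul_add]
  rw [integral_add h2 h5, h3, h6, ← integral_add h1 h4]

theorem fderiv_mul_weight {χ : ℝ → ℝ} (hχ : ContDiff ℝ ∞ χ) (hp : ContDiff ℝ ∞ p) (z : ℝ × ℝ) :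
    fderiv ℝ (fun z : ℝ × ℝ => χ z.1 * p z.2) z (0, 1) = χ z.1 * deriv p z.2 :=
  (hasDerivAt_snd (η := fun z => χ z.1 * p z.2)
    ((hχ.comp contDiff_fst).mul (hp.comp contDiff_snd)) z).unique
    ((hp.differentiable (by simp) z.2).hasDerivAt.const_mul (χ z.1))

/-- The Gauss-Green formula for the sides `x₂ = ±a`. -/
theorem green_sideValue (hl : 0 < l) (ha : 0 < a) (hu : MemLp u 2 (lebRect l a))
    (hw : IsWeakPartial (rect l a) (0, 1) u g) (hp : ContDiff ℝ ∞ p) (hp1 : p a = 1)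
    (hp0 : p (-a) = 0) (hq : ContDiff ℝ ∞ q) (hq0 : q a = 0) (hq1 : q (-a) = 1)
    {η : ℝ × ℝ → ℝ} (hη : ContDiff ℝ ∞ η) :
    ∫ z in rect l a, (fderiv ℝ η z (0, 1) • u z + η z • g z) =
      (∫ x in Ioo (-l) l, η (x, a) • sideValue a p u g x) +
        ∫ x in Ioo (-l) l, η (x, -a) • sideValue a q u g x := by
  have ht : ContDiff ℝ ∞ fun x => η (x, a) := hη.comp (by fun_prop)
  have hb : ContDiff ℝ ∞ fun x => η (x, -a) := hη.comp (by fun_prop)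
  -- the formula is linear in `η`, and `η - P - Q` vanishes on both sides
  let P : ℝ × ℝ → ℝ := fun z => η (z.1, a) * p z.2
  let Q : ℝ × ℝ → ℝ := fun z => η (z.1, -a) * q z.2
  have hP : ContDiff ℝ ∞ P := (ht.comp contDiff_fst).mul (hp.comp contDiff_snd)
  have hQ : ContDiff ℝ ∞ Q := (hb.comp contDiff_fst).mul (hq.comp contDiff_snd)
  have h0 := weak_green_of_vanishing hl ha hu hw ((hη.sub hP).sub hQ)
    (fun x => by simp [P, Q, hp1, hq0]) (fun x => by simp [P, Q, hp0, hq1])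
  rw [integral_smul_sideValue ht.continuous hp hu hw.1,
    integral_smul_sideValue hb.continuous hq hu hw.1]
  have hd (z : ℝ × ℝ) : fderiv ℝ (fun z => η z - P z - Q z) z (0, 1) =
      fderiv ℝ η z (0, 1) - η (z.1, a) * deriv p z.2 - η (z.1, -a) * deriv q z.2 := by
    rw [fderiv_fun_sub ((hη.sub hP).differentiable (by simp) z) (hQ.differentiable (by simp) z),
      fderiv_fun_sub (hη.differentiable (by simp) z) (hP.differentiable (by simp) z)]
    simp only [sub_apply]
    rw [fderiv_mul_weight ht hp, fderiv_mul_weight hb hq]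
  have hI {F : ℝ × ℝ → ℝ} (hF : ContDiff ℝ ∞ F) :
      Integrable (fun z => fderiv ℝ F z (0, 1) • u z + F z • g z) (lebRect l a) :=
    (integrable_smul_lebRect (continuous_fderiv_apply hF _) hu).add
      (integrable_smul_lebRect hF.continuous hw.1)
  have hIP := hI hP
  have hIQ := hI hQ
  simp only [P, Q, fderiv_mul_weight ht hp, fderiv_mul_weight hb hq] at hIP hIQ
  have hID := (hI hη).sub hIP
  simp only [Pi.sub_def] at hID
  rw [← sub_eq_zero, ← sub_sub, ← integral_sub (hI hη) hIP, ← integral_sub hID hIQ, ← h0]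
  refine integral_congr_ae (ae_of_all _ fun z => ?_)
  simp only [hd, P, Q]
  module

theorem measurePreserving_swap_lebRect (l a : ℝ) :
    MeasurePreserving Prod.swap (lebRect a l) (lebRect l a) := by
  rw [lebRect_eq_prod, lebRect_eq_prod]
  exact Measure.measurePreserving_swap

theorem integral_swap_rect (l a : ℝ) (F : ℝ × ℝ → ℂ) :
    ∫ z in rect a l, F z.swap = ∫ z in rect l a, F z :=
  (measurePreserving_swap_lebRect l a).integral_comp
    MeasurableEquiv.prodComm.measurableEmbedding F

theorem fderiv_comp_swap {η : ℝ × ℝ → ℝ} (hη : ContDiff ℝ ∞ η) (z e : ℝ × ℝ) :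
    fderiv ℝ (fun z => η z.swap) z e = fderiv ℝ η z.swap e.swap := by
  have h1 : HasFDerivAt (fun z : ℝ × ℝ => z.swap)
      (ContinuousLinearEquiv.prodComm ℝ ℝ ℝ : ℝ × ℝ →L[ℝ] ℝ × ℝ) z :=
    (ContinuousLinearEquiv.prodComm ℝ ℝ ℝ).hasFDerivAt
  have h2 := ((hη.differentiable (by simp) z.swap).hasFDerivAt.comp z h1).fderiv
  have h3 := congrArg (fun T : ℝ × ℝ →L[ℝ] ℝ => T e) h2
  exact h3

theorem contDiff_comp_swap {η : ℝ × ℝ → ℝ} (hη : ContDiff ℝ ∞ η) :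
    ContDiff ℝ ∞ fun z : ℝ × ℝ => η z.swap :=
  hη.comp (contDiff_snd.prodMk contDiff_fst)

theorem IsWeakPartial.swap (h : IsWeakPartial (rect l a) (1, 0) u g) :
    IsWeakPartial (rect a l) (0, 1) (fun z => u z.swap) fun z => g z.swap := by
  refine ⟨h.1.comp_measurePreserving (measurePreserving_swap_lebRect l a), fun η hη hc hs => ?_⟩
  have e1 := h.2 (fun z => η z.swap) (contDiff_comp_swap hη)
    (hc.comp_homeomorph (Homeomorph.prodComm ℝ ℝ)) (by
      have := tsupport_comp_eq_preimage η (Homeomorph.prodComm ℝ ℝ)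
      intro z hz
      have h1 : z ∈ (Homeomorph.prodComm ℝ ℝ) ⁻¹' tsupport η := this ▸ hz
      have h2 := hs h1
      exact ⟨h2.2, h2.1⟩)
  rw [← integral_swap_rect l a (fun z => _ • u z),
    ← integral_swap_rect l a (fun z => _ • g z)] at e1
  simpa only [fderiv_comp_swap hη, Prod.swap_swap, Prod.swap_prod_mk] using e1

/-- The affine weight that is `1` at `a` and `0` at `-a`, raised to a power: a large power makes its
`L²` norm small. -/
noncomputable def endWeight (a : ℝ) (n : ℕ) (y : ℝ) : ℝ := ((y + a) / (2 * a)) ^ n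

theorem contDiff_endWeight (a : ℝ) (n : ℕ) : ContDiff ℝ ∞ (endWeight a n) := by
  unfold endWeight; fun_prop

theorem contDiff_endWeight_neg (a : ℝ) (n : ℕ) : ContDiff ℝ ∞ fun y => endWeight a n (-y) := by
  unfold endWeight; fun_prop

theorem endWeight_right (ha : 0 < a) (n : ℕ) : endWeight a n a = 1 := by
  rw [endWeight, ← two_mul, div_self (by positivity), one_pow]

theorem endWeight_left {n : ℕ} (hn : n ≠ 0) : endWeight a n (-a) = 0 := by
  simp [endWeight, hn]

theorem exists_side_traces (hl : 0 < l) (ha : 0 < a) (hu : MemLp u 2 (lebRect l a))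
    (hw : IsWeakPartial (rect l a) (0, 1) u g) :
    ∃ t b : ℝ → ℂ, MemLp t 2 (volume.restrict (Ioo (-l) l)) ∧
      MemLp b 2 (volume.restrict (Ioo (-l) l)) ∧ ∀ η : ℝ × ℝ → ℝ, ContDiff ℝ ∞ η →
        ∫ z in rect l a, (fderiv ℝ η z (0, 1) • u z + η z • g z) =
          (∫ x in Ioo (-l) l, η (x, a) • t x) - ∫ x in Ioo (-l) l, η (x, -a) • b x := by
  refine ⟨sideValue a (endWeight a 1) u g, -sideValue a (fun y => endWeight a 1 (-y)) u g,
    memLp_sideValue (contDiff_endWeight a 1) hu hw.1,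
    (memLp_sideValue (contDiff_endWeight_neg a 1) hu hw.1).neg, fun η hη => ?_⟩
  rw [green_sideValue hl ha hu hw (contDiff_endWeight a 1) (endWeight_right ha 1)
    (endWeight_left one_ne_zero) (contDiff_endWeight_neg a 1) (endWeight_left one_ne_zero)
    (by rw [neg_neg]; exact endWeight_right ha 1) hη]
  simp only [Pi.neg_apply, smul_neg, integral_neg, sub_neg_eq_add]

/-- Sobolev functions on the rectangle have traces. -/
theorem exists_isTrace (hl : 0 < l) (ha : 0 < a) (h : MemW12 l a u) : ∃ t, IsTrace l a u t := by
  obtain ⟨T, B, hT, hB, hTB⟩ := exists_side_traces hl ha h.1 h.isWeakPartial_d2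
  obtain ⟨R, L, hR, hL, hRL⟩ := exists_side_traces ha hl
    (h.1.comp_measurePreserving (measurePreserving_swap_lebRect l a)) h.isWeakPartial_d1.swap
  let t : ℝ × ℝ → ℂ := fun z =>
    if z.1 = l then R z.2 else if z.1 = -l then L z.2 else if z.2 = a then T z.1 else B z.1
  have tR (y : ℝ) : t (l, y) = R y := if_pos rfl
  have tL (y : ℝ) : t (-l, y) = L y := (if_neg (neg_lt_self hl).ne).trans (if_pos rfl)
  have tT : ∀ᵐ x ∂(volume.restrict (Ioo (-l) l)), t (x, a) = T x := by
    filter_upwards [ae_restrict_mem measurableSet_Ioo] with x hx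
    exact (if_neg hx.2.ne).trans ((if_neg hx.1.ne').trans (if_pos rfl))
  have tB : ∀ᵐ x ∂(volume.restrict (Ioo (-l) l)), t (x, -a) = B x := by
    filter_upwards [ae_restrict_mem measurableSet_Ioo] with x hx
    exact (if_neg hx.2.ne).trans ((if_neg hx.1.ne').trans (if_neg (neg_lt_self ha).ne))
  refine ⟨t, ?_, ?_, (memLp_congr_ae tT).2 hT, (memLp_congr_ae tB).2 hB, fun η hη => ?_,
    fun η hη => ?_⟩
  · simpa only [tR] using hR
  · simpa only [tL] using hL
  · have h1 := hRL (fun z => η z.swap) (contDiff_comp_swap hη)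
    simp only [fderiv_comp_swap hη, Prod.swap_prod_mk, Function.comp_apply] at h1
    rw [integral_swap_rect l a (fun z => fderiv ℝ η z (1, 0) • u z + η z • d1 l a u z)] at h1
    simpa only [tR, tL] using h1
  · rw [hTB η hη]
    congr 1
    · exact integral_congr_ae (tT.mono fun x hx => by simp only [hx])
    · exact integral_congr_ae (tB.mono fun x hx => by simp only [hx])

theorem MemW12.isTrace (hl : 0 < l) (ha : 0 < a) (h : MemW12 l a u) :
    IsTrace l a u (trace l a u) := by
  have := exists_isTrace hl ha h
  rw [trace, dif_pos this]; exact this.choose_spec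

/-- The trace does not depend on the weight `p`; its norm can therefore be estimated with any
weight. -/
theorem trace_top_ae_eq (hl : 0 < l) (ha : 0 < a) (h : MemW12 l a u) (hp : ContDiff ℝ ∞ p)
    (hp1 : p a = 1) (hp0 : p (-a) = 0) :
    (fun x => trace l a u (x, a)) =ᵐ[volume.restrict (Ioo (-l) l)]
      sideValue a p u (d2 l a u) := by
  have ht := h.isTrace hl ha
  refine ae_eq_of_integral_test_eq isOpen_Ioo (ht.memLp_top.integrable (by norm_num))
    ((memLp_sideValue hp h.1 h.isWeakPartial_d2.1).integrable (by norm_num))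
    fun χ hχ _ _ => ?_
  rw [integral_smul_sideValue hχ.continuous hp h.1 h.isWeakPartial_d2.1]
  have h1 := ht.green₂ _ ((hχ.comp contDiff_fst).mul (hp.comp contDiff_snd))
  have h2 := fderiv_mul_weight hχ hp
  simp only [Function.comp_apply, hp1, hp0, mul_one, mul_zero, zero_smul, integral_zero,
    sub_zero] at h1
  rw [← h1]
  exact integral_congr_ae (ae_of_all _ fun z => by simp only [← h2])

theorem trace_bot_ae_eq (hl : 0 < l) (ha : 0 < a) (h : MemW12 l a u) (hp : ContDiff ℝ ∞ p)
    (hp0 : p a = 0) (hp1 : p (-a) = -1) :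
    (fun x => trace l a u (x, -a)) =ᵐ[volume.restrict (Ioo (-l) l)]
      sideValue a p u (d2 l a u) := by
  have ht := h.isTrace hl ha
  refine ae_eq_of_integral_test_eq isOpen_Ioo (ht.memLp_bot.integrable (by norm_num))
    ((memLp_sideValue hp h.1 h.isWeakPartial_d2.1).integrable (by norm_num))
    fun χ hχ _ _ => ?_
  rw [integral_smul_sideValue hχ.continuous hp h.1 h.isWeakPartial_d2.1]
  have h1 := ht.green₂ _ ((hχ.comp contDiff_fst).mul (hp.comp contDiff_snd))
  have h2 := fderiv_mul_weight hχ hp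
  simp only [Function.comp_apply, hp1, hp0, mul_neg, mul_one, mul_zero, zero_smul, neg_smul,
    integral_zero, integral_neg, zero_sub, neg_neg] at h1
  rw [← h1]
  exact integral_congr_ae (ae_of_all _ fun z => by simp only [← h2])

/-- Periodicity as a condition on `∂₁ u`: the mean of `∂₁ u` over almost every horizontal section
vanishes. -/
theorem memW12per_iff (hl : 0 < l) (ha : 0 < a) :
    MemW12per l a u ↔ MemW12 l a u ∧ ∀ χ : ℝ → ℝ, ContDiff ℝ ∞ χ → HasCompactSupport χ →
      tsupport χ ⊆ Ioo (-a) a → ∫ z in rect l a, χ z.2 • d1 l a u z = 0 := by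
  refine and_congr_right fun h => ?_
  have ht := h.isTrace hl ha
  have hL : IntegrableOn (fun y => trace l a u (-l, y)) (Ioo (-a) a) :=
    ht.memLp_left.integrable (by norm_num)
  have hR : IntegrableOn (fun y => trace l a u (l, y)) (Ioo (-a) a) :=
    ht.memLp_right.integrable (by norm_num)
  have key (χ : ℝ → ℝ) (hχ : ContDiff ℝ ∞ χ) : ∫ z in rect l a, χ z.2 • d1 l a u z =
      (∫ y in Ioo (-a) a, χ y • trace l a u (l, y)) -
        ∫ y in Ioo (-a) a, χ y • trace l a u (-l, y) := by
    rw [← ht.green₁ (fun z => χ z.2) (hχ.comp contDiff_snd)]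
    refine integral_congr_ae (ae_of_all _ fun z => ?_)
    have h1 : fderiv ℝ (fun z : ℝ × ℝ => χ z.2) z (1, 0) = 0 := by
      have h2 := (hχ.differentiable (by simp) z.2).hasFDerivAt.comp z
        (hasFDerivAt_snd (𝕜 := ℝ) (p := z))
      exact (congrArg (fun T : ℝ × ℝ →L[ℝ] ℝ => T (1, 0)) h2.fderiv).trans (by simp)
    simp only [h1, zero_smul, zero_add]
  constructor
  · intro hper χ hχ _ _
    rw [key χ hχ, sub_eq_zero]
    exact integral_congr_ae (hper.mono fun y hy => by simp only [hy])
  · intro hper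
    exact ae_eq_of_integral_test_eq isOpen_Ioo hL hR fun χ h1 h2 h3 =>
      (sub_eq_zero.1 ((key χ h1).symm.trans (hper χ h1 h2 h3))).symm

end Traces
/-! ### The form domain as a Hilbert space -/

section FormSpace

variable {l a : ℝ} {f : ℝ × ℝ → ℝ} {C : ℝ}

/-- Triples of square-integrable functions for the Riemannian measure, meant for a function and its
two partial derivatives. -/
abbrev Triples (l a : ℝ) (f : ℝ × ℝ → ℝ) : Type := PiLp 2 fun _ : Fin 3 => L2G l a f

/-- The `i`-th component of a triple. -/
noncomputable abbrev component (l a : ℝ) (f : ℝ × ℝ → ℝ) (i : Fin 3) :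
    Triples l a f →L[ℂ] L2G l a f :=
  PiLp.proj 2 (fun _ : Fin 3 => L2G l a f) i

theorem isClosed_iInf_ker {ι E : Type*} [NormedAddCommGroup E] [NormedSpace ℂ E]
    (L : ι → E →L[ℂ] ℂ) : IsClosed ((⨅ i, (L i).ker : Submodule ℂ E) : Set E) := by
  rw [Submodule.coe_iInf]
  exact isClosed_iInter fun i => (L i).isClosed_ker

theorem memLp_lebRect_coe (hC0 : 0 < C) (hC : ∀ᵐ x ∂(lebRect l a), C⁻¹ ≤ f x ∧ f x ≤ C)
    (u : L2G l a f) : MemLp u 2 (lebRect l a) :=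
  (memLp_muG_iff hC0 hC).1 (Lp.memLp u)

theorem exists_test_clm (hC0 : 0 < C) (hC : ∀ᵐ x ∂(lebRect l a), C⁻¹ ≤ f x ∧ f x ≤ C)
    {w : ℝ × ℝ → ℝ} (hw : Continuous w) :
    ∃ L : L2G l a f →L[ℂ] ℂ, ∀ u, L u = ∫ z in rect l a, w z • u z := by
  obtain ⟨I, hI⟩ := exists_restrict_clm ENNReal.ofReal_ne_top (le_muG hC0 hC)
  obtain ⟨L, hL⟩ := exists_pairing_clm (memLp_lebRect_of_continuous l a hw 2)
  refine ⟨L ∘L I, fun u => ?_⟩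
  change L (I u) = _
  rw [hL]
  exact integral_congr_ae ((hI u).mono fun z hz => by simp only [hz])

/-- The triples `(u, ∂₁ u, ∂₂ u)` with `u` in the periodic Sobolev space form a closed subspace. -/
theorem exists_formSpace (hl : 0 < l) (ha : 0 < a) (hC0 : 0 < C)
    (hC : ∀ᵐ x ∂(lebRect l a), C⁻¹ ≤ f x ∧ f x ≤ C) :
    ∃ V : Submodule ℂ (Triples l a f), IsClosed (V : Set (Triples l a f)) ∧
      ∀ v, v ∈ V ↔ MemW12per l a (v 0) ∧ d1 l a (v 0) =ᵐ[lebRect l a] v 1 ∧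
        d2 l a (v 0) =ᵐ[lebRect l a] v 2 := by
  choose L hL using fun (w : ℝ × ℝ → ℝ) (hw : Continuous w) =>
    exists_test_clm (f := f) hC0 hC (w := w) hw
  let ι := {η : ℝ × ℝ → ℝ // ContDiff ℝ ∞ η ∧ HasCompactSupport η ∧ tsupport η ⊆ rect l a}
  let κ := {χ : ℝ → ℝ // ContDiff ℝ ∞ χ ∧ HasCompactSupport χ ∧ tsupport χ ⊆ Ioo (-a) a}
  let D (e : ℝ × ℝ) (i : Fin 3) (η : ι) : Triples l a f →L[ℂ] ℂ :=
    L _ (continuous_fderiv_apply η.2.1 e) ∘L component l a f 0 +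
      L _ η.2.1.continuous ∘L component l a f i
  let P (χ : κ) : Triples l a f →L[ℂ] ℂ :=
    L (fun z => χ.1 z.2) (χ.2.1.continuous.comp continuous_snd) ∘L component l a f 1
  have hD (e : ℝ × ℝ) (i : Fin 3) (v : Triples l a f) :
      v ∈ (⨅ η, (D e i η).ker : Submodule ℂ (Triples l a f)) ↔
        IsWeakPartial (rect l a) e (v 0) (v i) := by
    simp only [Submodule.mem_iInf, LinearMap.mem_ker]
    have h1 (η : ι) : D e i η v = (∫ z in rect l a, fderiv ℝ η.1 z e • v 0 z) +
        ∫ z in rect l a, η.1 z • v i z := by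
      rw [← hL, ← hL]; rfl
    constructor
    · intro h
      refine ⟨memLp_lebRect_coe hC0 hC _, fun η h2 h3 h4 => ?_⟩
      rw [eq_neg_iff_add_eq_zero]
      exact (h1 ⟨η, h2, h3, h4⟩).symm.trans (h ⟨η, h2, h3, h4⟩)
    · intro h η
      refine (h1 η).trans ?_
      rw [← eq_neg_iff_add_eq_zero]
      exact h.2 η.1 η.2.1 η.2.2.1 η.2.2.2
  have hP (v : Triples l a f) : v ∈ (⨅ χ, (P χ).ker : Submodule ℂ (Triples l a f)) ↔
      ∀ χ : ℝ → ℝ, ContDiff ℝ ∞ χ → HasCompactSupport χ → tsupport χ ⊆ Ioo (-a) a →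
        ∫ z in rect l a, χ z.2 • v 1 z = 0 := by
    simp only [Submodule.mem_iInf, LinearMap.mem_ker]
    have h1 (χ : κ) : P χ v = ∫ z in rect l a, χ.1 z.2 • v 1 z := by
      rw [← hL (fun z => χ.1 z.2) (χ.2.1.continuous.comp continuous_snd)]; rfl
    exact ⟨fun h χ h2 h3 h4 => (h1 ⟨χ, h2, h3, h4⟩).symm.trans (h ⟨χ, h2, h3, h4⟩),
      fun h χ => (h1 χ).trans (h χ.1 χ.2.1 χ.2.2.1 χ.2.2.2)⟩
  refine ⟨(⨅ η, (D (1, 0) 1 η).ker) ⊓ (⨅ η, (D (0, 1) 2 η).ker) ⊓ ⨅ χ, (P χ).ker,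
    ((isClosed_iInf_ker _).inter (isClosed_iInf_ker _)).inter (isClosed_iInf_ker _), fun v => ?_⟩
  rw [Submodule.mem_inf, Submodule.mem_inf, hD, hD, hP, memW12per_iff hl ha]
  constructor
  · rintro ⟨⟨h1, h2⟩, h3⟩
    refine ⟨⟨⟨memLp_lebRect_coe hC0 hC _, ⟨_, h1⟩, ⟨_, h2⟩⟩, fun χ h4 h5 h6 => ?_⟩,
      h1.weakPartial_ae_eq, h2.weakPartial_ae_eq⟩
    rw [← h3 χ h4 h5 h6]
    exact integral_congr_ae (h1.weakPartial_ae_eq.mono fun z hz => by simp only [d1, hz])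
  · rintro ⟨⟨h1, h2⟩, h3, h4⟩
    refine ⟨⟨⟨memLp_lebRect_coe hC0 hC _, fun η h5 h6 h7 => ?_⟩,
      ⟨memLp_lebRect_coe hC0 hC _, fun η h5 h6 h7 => ?_⟩⟩, fun χ h5 h6 h7 => ?_⟩
    · rw [h1.isWeakPartial_d1.2 η h5 h6 h7]
      exact congrArg _ (integral_congr_ae (h3.mono fun z hz => by simp only [hz]))
    · rw [h1.isWeakPartial_d2.2 η h5 h6 h7]
      exact congrArg _ (integral_congr_ae (h4.mono fun z hz => by simp only [hz]))
    · rw [← h2 χ h5 h6 h7]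
      exact integral_congr_ae (h3.mono fun z hz => by simp only [hz])

/-- Every element of the periodic Sobolev space is the first entry of such a triple. -/
theorem exists_triple (hC0 : 0 < C) (hC : ∀ᵐ x ∂(lebRect l a), C⁻¹ ≤ f x ∧ f x ≤ C)
    {u : L2G l a f} (hu : MemW12 l a u) : ∃ v : Triples l a f, v 0 = u ∧
      d1 l a u =ᵐ[lebRect l a] v 1 ∧ d2 l a u =ᵐ[lebRect l a] v 2 := by
  have h1 := (memLp_muG_iff hC0 hC).2 hu.isWeakPartial_d1.1
  have h2 := (memLp_muG_iff hC0 hC).2 hu.isWeakPartial_d2.1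
  refine ⟨WithLp.toLp 2 ![u, h1.toLp, h2.toLp], rfl, ?_, ?_⟩
  · rw [EventuallyEq, ← ae_muG_eq hC0 hC]; exact h1.coeFn_toLp.symm
  · rw [EventuallyEq, ← ae_muG_eq hC0 hC]; exact h2.coeFn_toLp.symm

end FormSpace

/-! ### Test functions -/

section Density

variable {l a : ℝ} {f : ℝ × ℝ → ℝ} {C : ℝ}

theorem setIntegral_rect_eq {F : ℝ × ℝ → ℝ} {η : ℝ × ℝ → ℝ} (hs : tsupport η ⊆ rect l a)
    (hF : ∀ z, z ∉ tsupport η → F z = 0) : ∫ z in rect l a, F z = ∫ z, F z :=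
  setIntegral_eq_integral_of_forall_compl_eq_zero fun z hz => hF z fun h => hz (hs h)

theorem integral_fderiv_test {η θ : ℝ × ℝ → ℝ} (hη : ContDiff ℝ ∞ η) (hc : HasCompactSupport η)
    (hs : tsupport η ⊆ rect l a) (hθ : ContDiff ℝ ∞ θ) (e : ℝ × ℝ) :
    ∫ z in rect l a, fderiv ℝ θ z e * η z = -∫ z in rect l a, θ z * fderiv ℝ η z e := by
  have h0 (z : ℝ × ℝ) (hz : z ∉ tsupport η) : η z = 0 := image_eq_zero_of_notMem_tsupport hz
  have h1 (z : ℝ × ℝ) (hz : z ∉ tsupport η) : fderiv ℝ η z e = 0 := by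
    rw [image_eq_zero_of_notMem_tsupport fun h => hz (tsupport_fderiv_subset ℝ h)]; rfl
  rw [setIntegral_rect_eq hs fun z hz => by rw [h0 z hz, mul_zero],
    setIntegral_rect_eq hs fun z hz => by rw [h1 z hz, mul_zero]]
  have hcη : HasCompactSupport fun z => fderiv ℝ η z e :=
    hc.mono' fun z hz => by
      by_contra h
      exact hz (h1 z h)
  rw [integral_mul_fderiv_eq_neg_fderiv_mul_of_integrable, neg_neg]
  · exact ((continuous_fderiv_apply hθ e).mul hη.continuous).integrable_of_hasCompactSupport
      hc.mul_left
  · exact (hθ.continuous.mul (continuous_fderiv_apply hη e)).integrable_of_hasCompactSupport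
      hcη.mul_left
  · exact (hθ.continuous.mul hη.continuous).integrable_of_hasCompactSupport hc.mul_left
  · exact fun z _ => hθ.differentiable (by simp) z
  · exact fun z _ => hη.differentiable (by simp) z

theorem isWeakPartial_test {η : ℝ × ℝ → ℝ} (hη : ContDiff ℝ ∞ η) (hc : HasCompactSupport η)
    (hs : tsupport η ⊆ rect l a) (e : ℝ × ℝ) :
    IsWeakPartial (rect l a) e (fun z => (η z : ℂ)) fun z => (fderiv ℝ η z e : ℂ) := by
  refine ⟨(memLp_lebRect_of_continuous l a (continuous_fderiv_apply hη e) 2).ofReal,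
    fun θ hθ _ _ => ?_⟩
  simp only [Complex.real_smul, ← Complex.ofReal_mul]
  rw [integral_complex_ofReal, integral_complex_ofReal, integral_fderiv_test hη hc hs hθ e,
    Complex.ofReal_neg]

theorem IsWeakPartial.congr_left {U : Set (ℝ × ℝ)} {e : ℝ × ℝ} {u u' g : ℝ × ℝ → ℂ}
    (h : IsWeakPartial U e u g) (hu : u' =ᵐ[volume.restrict U] u) : IsWeakPartial U e u' g :=
  ⟨h.1, fun η h1 h2 h3 => by
    rw [← h.2 η h1 h2 h3]
    exact integral_congr_ae (hu.mono fun z hz => by simp only [hz])⟩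

theorem memW12per_of_ae_eq_test (hl : 0 < l) (ha : 0 < a) {η : ℝ × ℝ → ℝ} (hη : ContDiff ℝ ∞ η)
    (hc : HasCompactSupport η) (hs : tsupport η ⊆ rect l a) {u : ℝ × ℝ → ℂ}
    (hu : u =ᵐ[lebRect l a] fun z => (η z : ℂ)) : MemW12per l a u := by
  have h (e : ℝ × ℝ) := (isWeakPartial_test hη hc hs e).congr_left hu
  rw [memW12per_iff hl ha]
  refine ⟨⟨(memLp_congr_ae hu).2 (memLp_lebRect_of_continuous l a hη.continuous 2).ofReal,
    ⟨_, h (1, 0)⟩, ⟨_, h (0, 1)⟩⟩, fun χ hχ _ _ => ?_⟩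
  have hχ' : ContDiff ℝ ∞ fun z : ℝ × ℝ => χ z.2 := hχ.comp contDiff_snd
  have h2 : ∫ z in rect l a, χ z.2 • d1 l a u z =
      ∫ z in rect l a, ((χ z.2 * fderiv ℝ η z (1, 0) : ℝ) : ℂ) :=
    integral_congr_ae ((h (1, 0)).weakPartial_ae_eq.mono fun z hz => by
      simp only [d1, hz, Complex.real_smul, Complex.ofReal_mul])
  have h3 (z : ℝ × ℝ) : fderiv ℝ (fun z : ℝ × ℝ => χ z.2) z (1, 0) = 0 := by
    have h4 := (hχ.differentiable (by simp) z.2).hasFDerivAt.comp z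
      (hasFDerivAt_snd (𝕜 := ℝ) (p := z))
    exact (congrArg (fun T : ℝ × ℝ →L[ℝ] ℝ => T (1, 0)) h4.fderiv).trans (by simp)
  rw [h2, integral_complex_ofReal, ← neg_neg (∫ z in rect l a, χ z.2 * _),
    ← integral_fderiv_test hη hc hs hχ']
  simp [h3]

/-- Only zero is orthogonal to the periodic Sobolev space, which contains the test functions. -/
theorem eq_zero_of_orthogonal_memW12per (hl : 0 < l) (ha : 0 < a)
    (hf : AEMeasurable f (lebRect l a)) (hC0 : 0 < C)
    (hC : ∀ᵐ x ∂(lebRect l a), C⁻¹ ≤ f x ∧ f x ≤ C) {F : L2G l a f}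
    (hF : ∀ φ : L2G l a f, MemW12per l a φ → inner ℂ φ F = 0) : F = 0 := by
  have hfF : Integrable (fun z => f z • F z) (lebRect l a) := by
    refine ((memLp_lebRect_coe hC0 hC F).integrable (by norm_num)).bdd_smul C
      hf.aestronglyMeasurable ?_
    filter_upwards [hC] with z hz
    rw [Real.norm_of_nonneg ((inv_pos.2 hC0).le.trans hz.1)]
    exact hz.2
  have h0 : (fun z => f z • F z) =ᵐ[lebRect l a] fun _ => 0 := by
    refine ae_eq_of_integral_test_eq (isOpen_rect l a) hfF (integrable_zero _ _ _)
      fun η hη hc hs => ?_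
    have hmem : MemLp (fun z => (η z : ℂ)) 2 (muG l a f) :=
      (memLp_muG_iff hC0 hC).2 (memLp_lebRect_of_continuous l a hη.continuous 2).ofReal
    have hper : MemW12per l a hmem.toLp := by
      refine memW12per_of_ae_eq_test hl ha hη hc hs ?_
      rw [EventuallyEq, ← ae_muG_eq hC0 hC]
      exact hmem.coeFn_toLp
    have h1 := hF _ hper
    have h2 : ∫ z, η z • F z ∂(muG l a f) = 0 := by
      rw [← h1, L2.inner_def]
      refine integral_congr_ae (hmem.coeFn_toLp.mono fun z hz => ?_)
      simp only [hz]
      simp [mul_comm]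
    have h3 := integral_withDensity_eq_integral_toReal_smul₀ hf.ennreal_ofReal
      (ae_of_all _ fun _ => ENNReal.ofReal_lt_top) fun z => η z • F z
    simp only [smul_zero, integral_zero]
    rw [← h2]
    refine Eq.trans ?_ h3.symm
    refine integral_congr_ae (hC.mono fun z hz => ?_)
    simp only
    rw [ENNReal.toReal_ofReal ((inv_pos.2 hC0).le.trans hz.1), smul_comm]
  rw [Lp.eq_zero_iff_ae_eq_zero, EventuallyEq, ae_muG_eq hC0 hC]
  filter_upwards [h0, hC] with z h1 h2
  exact (smul_eq_zero.1 h1).resolve_left ((inv_pos.2 hC0).trans_le h2.1).ne'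

end Density
/-! ### The trace operators and their relative smallness -/

section TraceOperators

variable {l a : ℝ} {f : ℝ × ℝ → ℝ} {C : ℝ}

theorem tendsto_eLpNorm_zero_of_bounded {X : Type*} [MeasurableSpace X] {ρ : Measure X}
    [IsFiniteMeasure ρ] {w : ℕ → X → ℝ} (hm : ∀ n, AEStronglyMeasurable (w n) ρ)
    (hb : ∀ n, ∀ᵐ y ∂ρ, |w n y| ≤ 1) (hlim : ∀ᵐ y ∂ρ, Tendsto (fun n => w n y) atTop (𝓝 0)) :
    Tendsto (fun n => eLpNorm (w n) 2 ρ) atTop (𝓝 0) := by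
  have h1 : Tendsto (fun n => ∫⁻ y, ‖w n y‖ₑ ^ (2 : ℝ) ∂ρ) atTop (𝓝 (∫⁻ _, 0 ∂ρ)) := by
    refine tendsto_lintegral_of_dominated_convergence' (fun _ => 1)
      (fun n => (hm n).enorm.pow_const _) (fun n => ?_) (by simp) ?_
    · filter_upwards [hb n] with y hy
      refine ENNReal.rpow_le_one ?_ (by norm_num)
      rw [← ofReal_norm, Real.norm_eq_abs]
      exact ENNReal.ofReal_le_one.2 hy
    · filter_upwards [hlim] with y hy
      have h2 := (ENNReal.continuous_rpow_const (y := (2 : ℝ))).tendsto ‖(0 : ℝ)‖ₑ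
      have h3 := h2.comp (hy.enorm)
      simpa [Function.comp_def] using h3
  have h4 := ((ENNReal.continuous_rpow_const (y := 1 / (2 : ℝ))).tendsto _).comp h1
  simp only [lintegral_zero] at h4
  rw [ENNReal.zero_rpow_of_pos (by norm_num)] at h4
  refine h4.congr fun n => ?_
  rw [eLpNorm_eq_lintegral_rpow_enorm_toReal (by simp) (by simp)]
  simp

theorem endWeight_bounds (ha : 0 < a) {y : ℝ} (hy : y ∈ Ioo (-a) a) :
    0 ≤ (y + a) / (2 * a) ∧ (y + a) / (2 * a) < 1 := by
  refine ⟨div_nonneg (by linarith [hy.1]) (by positivity), ?_⟩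
  rw [div_lt_one (by positivity)]
  linarith [hy.2]

theorem tendsto_eLpNorm_endWeight (ha : 0 < a) :
    Tendsto (fun n => eLpNorm (endWeight a (n + 1)) 2 (volume.restrict (Ioo (-a) a))) atTop
      (𝓝 0) := by
  refine tendsto_eLpNorm_zero_of_bounded
    (fun n => (contDiff_endWeight a _).continuous.aestronglyMeasurable) (fun n => ?_) ?_
  · filter_upwards [ae_restrict_mem measurableSet_Ioo] with y hy
    obtain ⟨h1, h2⟩ := endWeight_bounds ha hy
    rw [endWeight, abs_of_nonneg (pow_nonneg h1 _)]
    exact pow_le_one₀ h1 h2.le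
  · filter_upwards [ae_restrict_mem measurableSet_Ioo] with y hy
    obtain ⟨h1, h2⟩ := endWeight_bounds ha hy
    exact (tendsto_pow_atTop_nhds_zero_of_lt_one h1 h2).comp (tendsto_add_atTop_nat 1)

theorem tendsto_eLpNorm_endWeight_neg (ha : 0 < a) :
    Tendsto (fun n => eLpNorm (fun y => -endWeight a (n + 1) (-y)) 2
      (volume.restrict (Ioo (-a) a))) atTop (𝓝 0) := by
  refine tendsto_eLpNorm_zero_of_bounded
    (fun n => (contDiff_endWeight_neg a _).neg.continuous.aestronglyMeasurable) (fun n => ?_) ?_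
  · filter_upwards [ae_restrict_mem measurableSet_Ioo] with y hy
    obtain ⟨h1, h2⟩ := endWeight_bounds (y := -y) ha ⟨neg_lt_neg hy.2, neg_lt.1 hy.1⟩
    rw [abs_neg, endWeight, abs_of_nonneg (pow_nonneg h1 _)]
    exact pow_le_one₀ h1 h2.le
  · filter_upwards [ae_restrict_mem measurableSet_Ioo] with y hy
    obtain ⟨h1, h2⟩ := endWeight_bounds (y := -y) ha ⟨neg_lt_neg hy.2, neg_lt.1 hy.1⟩
    simpa [endWeight] using
      ((tendsto_pow_atTop_nhds_zero_of_lt_one h1 h2).comp (tendsto_add_atTop_nat 1)).neg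

/-- The side value as a bounded operator; the coefficient of the derivative in the bound is
proportional to the `L²` norm of the weight. -/
theorem exists_sideValue_clm (hC0 : 0 < C) (hC : ∀ᵐ x ∂(lebRect l a), C⁻¹ ≤ f x ∧ f x ≤ C) :
    ∃ J : ℝ, 0 ≤ J ∧ ∀ p : ℝ → ℝ, ContDiff ℝ ∞ p →
      ∃ (T : Triples l a f →L[ℂ] Lp ℂ 2 (volume.restrict (Ioo (-l) l))) (A : ℝ),
        (∀ v, T v =ᵐ[volume.restrict (Ioo (-l) l)] sideValue a p (v 0) (v 2)) ∧ 0 ≤ A ∧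
        ∀ v, ‖T v‖ ≤ A * ‖v 0‖ +
          (eLpNorm p 2 (volume.restrict (Ioo (-a) a))).toReal * J * ‖v 2‖ := by
  have hle : (volume.restrict (Ioo (-l) l)).prod (volume.restrict (Ioo (-a) a)) ≤
      ENNReal.ofReal C • muG l a f := by
    rw [← lebRect_eq_prod]; exact le_muG hC0 hC
  obtain ⟨I, hI⟩ := exists_restrict_clm ENNReal.ofReal_ne_top hle
  refine ⟨‖I‖, norm_nonneg _, fun p hp => ?_⟩
  have hp' := hp.continuous_deriv (by simp)
  obtain ⟨K', hK', hK'b⟩ := exists_kernel_clm (σ := volume.restrict (Ioo (-l) l))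
    (memLp_Ioo_of_continuous a hp' 2)
  obtain ⟨K, hK, hKb⟩ := exists_kernel_clm (σ := volume.restrict (Ioo (-l) l))
    (memLp_Ioo_of_continuous a hp.continuous 2)
  have hsec (u : L2G l a f) (w : ℝ → ℝ) : (fun x => ∫ y in Ioo (-a) a, w y • I u (x, y))
      =ᵐ[volume.restrict (Ioo (-l) l)] fun x => ∫ y in Ioo (-a) a, w y • u (x, y) := by
    filter_upwards [Measure.ae_ae_of_ae_prod (hI u)] with x hx
    exact integral_congr_ae (hx.mono fun y hy => by simp only [hy])
  refine ⟨K' ∘L I ∘L component l a f 0 + K ∘L I ∘L component l a f 2, ‖K'‖ * ‖I‖, fun v => ?_,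
    by positivity, fun v => ?_⟩
  · filter_upwards [Lp.coeFn_add (K' (I (v 0))) (K (I (v 2))), hK' (I (v 0)), hK (I (v 2)),
      hsec (v 0) (deriv p), hsec (v 2) p] with x h1 h2 h3 h4 h5
    refine h1.trans ?_
    rw [Pi.add_apply, h2, h3, h4, h5, sideValue]
  · calc _ ≤ ‖K' (I (v 0))‖ + ‖K (I (v 2))‖ := norm_add_le _ _
      _ ≤ ‖K'‖ * (‖I‖ * ‖v 0‖) +
          (eLpNorm p 2 (volume.restrict (Ioo (-a) a))).toReal * (‖I‖ * ‖v 2‖) := by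
        refine add_le_add ((K'.le_opNorm _).trans ?_) ((hKb _).trans ?_)
        · gcongr; exact I.le_opNorm _
        · gcongr; exact I.le_opNorm _
      _ = _ := by ring

/-- The trace on a horizontal side is a bounded operator, and it is bounded relative to `∂₂` with
relative bound zero. -/
theorem exists_trace_clm (hC0 : 0 < C) (hC : ∀ᵐ x ∂(lebRect l a), C⁻¹ ≤ f x ∧ f x ≤ C) {s : ℝ}
    {w : ℕ → ℝ → ℝ} (hw : ∀ n, ContDiff ℝ ∞ (w n))
    (hlim : Tendsto (fun n => eLpNorm (w n) 2 (volume.restrict (Ioo (-a) a))) atTop (𝓝 0))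
    (htr : ∀ (n : ℕ) (u : ℝ × ℝ → ℂ), MemW12 l a u → (fun x => trace l a u (x, s))
      =ᵐ[volume.restrict (Ioo (-l) l)] sideValue a (w n) u (d2 l a u)) :
    ∃ T : Triples l a f →L[ℂ] Lp ℂ 2 (volume.restrict (Ioo (-l) l)),
      (∀ v : Triples l a f, MemW12 l a (v 0) → d2 l a (v 0) =ᵐ[lebRect l a] v 2 →
        T v =ᵐ[volume.restrict (Ioo (-l) l)] fun x => trace l a (v 0) (x, s)) ∧
      ∀ ε : ℝ, 0 < ε → ∃ K : ℝ, ∀ v : Triples l a f, MemW12 l a (v 0) →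
        d2 l a (v 0) =ᵐ[lebRect l a] v 2 → ‖T v‖ ^ 2 ≤ ε * ‖v 2‖ ^ 2 + K * ‖v 0‖ ^ 2 := by
  obtain ⟨J, hJ0, hJ⟩ := exists_sideValue_clm (f := f) hC0 hC
  choose T A hT hA0 hA using fun n => hJ (w n) (hw n)
  have hTtr (n : ℕ) (v : Triples l a f) (h1 : MemW12 l a (v 0))
      (h2 : d2 l a (v 0) =ᵐ[lebRect l a] v 2) :
      T n v =ᵐ[volume.restrict (Ioo (-l) l)] fun x => trace l a (v 0) (x, s) := by
    refine (hT n v).trans (EventuallyEq.trans ?_ (htr n _ h1).symm)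
    rw [lebRect_eq_prod] at h2
    filter_upwards [Measure.ae_ae_of_ae_prod h2] with x hx
    exact congrArg _ (integral_congr_ae (hx.mono fun y hy => by simp only [hy]))
  refine ⟨T 0, hTtr 0, fun ε hε => ?_⟩
  have h1 : Tendsto (fun n => 2 * ((eLpNorm (w n) 2 (volume.restrict (Ioo (-a) a))).toReal * J) ^ 2)
      atTop (𝓝 0) := by
    have h2 := (ENNReal.tendsto_toReal ENNReal.zero_ne_top).comp hlim
    simpa using (((h2.mul_const J).pow 2).const_mul 2)
  obtain ⟨n, hn⟩ := (h1.eventually (gt_mem_nhds hε)).exists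
  refine ⟨2 * A n ^ 2, fun v h2 h3 => ?_⟩
  have h4 : T 0 v = T n v := Lp.ext ((hTtr 0 v h2 h3).trans (hTtr n v h2 h3).symm)
  rw [h4]
  set B := (eLpNorm (w n) 2 (volume.restrict (Ioo (-a) a))).toReal * J
  have h5 : ‖T n v‖ ≤ A n * ‖v 0‖ + B * ‖v 2‖ := hA n v
  calc ‖T n v‖ ^ 2 ≤ (A n * ‖v 0‖ + B * ‖v 2‖) ^ 2 := by gcongr
    _ ≤ 2 * B ^ 2 * ‖v 2‖ ^ 2 + 2 * A n ^ 2 * ‖v 0‖ ^ 2 := by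
      nlinarith [sq_nonneg (A n * ‖v 0‖ - B * ‖v 2‖)]
    _ ≤ _ := by gcongr

end TraceOperators

/-! ### The operator of a form with bounded boundary coefficients -/

section BoundaryForm

variable {l a : ℝ} {f : ℝ × ℝ → ℝ}

theorem form1_eq_inner {C : ℝ} (hC0 : 0 < C) (hC : ∀ᵐ x ∂(lebRect l a), C⁻¹ ≤ f x ∧ f x ≤ C)
    {N : L2G l a f →L[ℂ] L2G l a f} (hN : ∀ u, N u =ᵐ[muG l a f] fun x => ((f x)⁻¹ : ℂ) * u x)
    {v w : Triples l a f} (hv1 : d1 l a (v 0) =ᵐ[lebRect l a] v 1)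
    (hv2 : d2 l a (v 0) =ᵐ[lebRect l a] v 2) (hw1 : d1 l a (w 0) =ᵐ[lebRect l a] w 1)
    (hw2 : d2 l a (w 0) =ᵐ[lebRect l a] w 2) :
    form1 l a f (v 0) (w 0) = inner ℂ (N (v 1)) (N (w 1)) + inner ℂ (v 2) (w 2) := by
  rw [EventuallyEq, ← ae_muG_eq hC0 hC] at hv1 hv2 hw1 hw2
  rw [form1, L2.inner_def, L2.inner_def, innerG, innerG]
  congr 1
  · refine integral_congr_ae ?_
    filter_upwards [hv1, hw1, hN (v 1), hN (w 1)] with x h1 h2 h3 h4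
    simp only [h1, h2, h3, h4, RCLike.inner_apply]
    exact mul_comm _ _
  · refine integral_congr_ae ?_
    filter_upwards [hv2, hw2] with x h1 h2
    simp only [h1, h2, RCLike.inner_apply]
    exact mul_comm _ _

/-- The boundary pairing with an essentially bounded coefficient `m`, as an inner product. -/
theorem bdryInner_eq_inner {s : ℝ} {m : ℝ → ℂ} {u w : ℝ × ℝ → ℂ}
    {M : Lp ℂ 2 (volume.restrict (Ioo (-l) l)) →L[ℂ] Lp ℂ 2 (volume.restrict (Ioo (-l) l))}
    (hM : ∀ u, M u =ᵐ[volume.restrict (Ioo (-l) l)] fun x => m x * (f (x, s) : ℂ) * u x)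
    {tu tw : Lp ℂ 2 (volume.restrict (Ioo (-l) l))} {s' : ℝ}
    (hu : tu =ᵐ[volume.restrict (Ioo (-l) l)] fun x => u (x, s))
    (hw : tw =ᵐ[volume.restrict (Ioo (-l) l)] fun x => w (x, s'))
    {w' : ℝ × ℝ → ℂ} (hw' : ∀ x, w' (x, s) = m x * w (x, s')) :
    bdryInner l f s u w' = inner ℂ tu (M tw) := by
  rw [bdryInner, L2.inner_def]
  refine integral_congr_ae ?_
  filter_upwards [hu, hw, hM tw] with x h1 h2 h3
  simp only [h1, h2, h3, hw', RCLike.inner_apply]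
  ring

end BoundaryForm
section OperatorOfForm

variable {l a : ℝ} {f : ℝ × ℝ → ℝ} {C : ℝ}

/-- Square-integrable functions on a horizontal side. -/
abbrev SideL2 (l : ℝ) : Type := Lp ℂ 2 (volume.restrict (Ioo (-l) l))

theorem norm_sq_triple (v : Triples l a f) :
    ‖v‖ ^ 2 = ‖v 0‖ ^ 2 + ‖v 1‖ ^ 2 + ‖v 2‖ ^ 2 := by
  rw [PiLp.norm_sq_eq_of_L2, Fin.sum_univ_three]

theorem abs_boundary_form_le {L : Type*} [NormedAddCommGroup L] [InnerProductSpace ℂ L]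
    (M₁₁ M₁₂ M₂₁ M₂₂ : L →L[ℂ] L) (t b : L) :
    |(inner ℂ t (M₁₁ t + M₁₂ b) + inner ℂ b (M₂₁ t + M₂₂ b)).re| ≤
      2 * (‖M₁₁‖ + ‖M₁₂‖ + ‖M₂₁‖ + ‖M₂₂‖) * (‖t‖ ^ 2 + ‖b‖ ^ 2) := by
  have h {x y z : L} {M M' : L →L[ℂ] L} : ‖inner ℂ x (M y + M' z)‖ ≤
      ‖x‖ * (‖M‖ * ‖y‖ + ‖M'‖ * ‖z‖) :=
    (norm_inner_le_norm _ _).trans (mul_le_mul_of_nonneg_left ((norm_add_le _ _).trans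
      (add_le_add (M.le_opNorm _) (M'.le_opNorm _))) (norm_nonneg _))
  refine ((Complex.abs_re_le_norm _).trans (norm_add_le _ _)).trans ((add_le_add h h).trans ?_)
  have h1 : ‖t‖ * ‖b‖ ≤ ‖t‖ ^ 2 + ‖b‖ ^ 2 := by 
    nlinarith [sq_nonneg (‖t‖ - ‖b‖), sq_nonneg (‖t‖), sq_nonneg (‖b‖)]
  have h2 : ‖t‖ ^ 2 ≤ ‖t‖ ^ 2 + ‖b‖ ^ 2 := by nlinarith [sq_nonneg (‖b‖)]
  have h3 : ‖b‖ ^ 2 ≤ ‖t‖ ^ 2 + ‖b‖ ^ 2 := by nlinarith [sq_nonneg (‖t‖)]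
  have h4 : 0 ≤ (‖M₁₁‖ + ‖M₁₂‖ + ‖M₂₁‖ + ‖M₂₂‖) * (‖t‖ ^ 2 + ‖b‖ ^ 2) := by positivity
  linarith [mul_le_mul_of_nonneg_left h2 (norm_nonneg M₁₁),
    mul_le_mul_of_nonneg_left h1 (norm_nonneg M₁₂),
    mul_le_mul_of_nonneg_left h1 (norm_nonneg M₂₁),
    mul_le_mul_of_nonneg_left h3 (norm_nonneg M₂₂)]

/-- The m-sectorial operator of a form that differs from `form1` by bounded couplings of the traces
on the horizontal sides. -/
theorem exists_unique_operator (hl : 0 < l) (ha : 0 < a) (hf : AEMeasurable f (lebRect l a))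
    (hC0 : 0 < C) (hC : ∀ᵐ x ∂(lebRect l a), C⁻¹ ≤ f x ∧ f x ≤ C)
    (h : (ℝ × ℝ → ℂ) → (ℝ × ℝ → ℂ) → ℂ) (M₁₁ M₁₂ M₂₁ M₂₂ : SideL2 l →L[ℂ] SideL2 l)
    (hh : ∀ (φ ψ : ℝ × ℝ → ℂ) (tφ bφ tψ bψ : SideL2 l),
      tφ =ᵐ[volume.restrict (Ioo (-l) l)] (fun x => trace l a φ (x, a)) →
      bφ =ᵐ[volume.restrict (Ioo (-l) l)] (fun x => trace l a φ (x, -a)) →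
      tψ =ᵐ[volume.restrict (Ioo (-l) l)] (fun x => trace l a ψ (x, a)) →
      bψ =ᵐ[volume.restrict (Ioo (-l) l)] (fun x => trace l a ψ (x, -a)) →
      h φ ψ = form1 l a f φ ψ +
        (inner ℂ tφ (M₁₁ tψ + M₁₂ bψ) + inner ℂ bφ (M₂₁ tψ + M₂₂ bψ))) :
    ∃ T : L2G l a f →ₗ.[ℂ] L2G l a f,
      IsMSectorial T ∧ Represents h T ∧ (∀ ψ : L2G l a f, ψ ∈ T.domain ↔ MemFormOpDomain h ψ) ∧
      ∀ T' : L2G l a f →ₗ.[ℂ] L2G l a f, IsMSectorial T' → Represents h T' → T' = T := by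
  obtain ⟨V, hVc, hV⟩ := exists_formSpace (f := f) hl ha hC0 hC
  have : CompleteSpace V := hVc.completeSpace_coe
  have hVof {u : L2G l a f} (hu : MemW12per l a u) : ∃ v : V, (v : Triples l a f) 0 = u := by
    obtain ⟨v, rfl, h1, h2⟩ := exists_triple hC0 hC hu.1
    exact ⟨⟨v, (hV v).2 ⟨hu, h1, h2⟩⟩, rfl⟩
  -- `N` is multiplication by `1 / f`; its inverse `Q` bounds `‖∂₁ u‖` by `‖N ∂₁ u‖`
  have hmeas : AEStronglyMeasurable f (muG l a f) :=
    hf.aestronglyMeasurable.mono_ac (Measure.absolutelyContinuous_of_le_smul (muG_le hC))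
  have hC' : ∀ᵐ x ∂(muG l a f), C⁻¹ ≤ f x ∧ f x ≤ C := by rw [ae_muG_eq hC0 hC]; exact hC
  have hfm : MemLp (fun x => (f x : ℂ)) ⊤ (muG l a f) := by
    refine memLp_top_of_bound (Complex.continuous_ofReal.comp_aestronglyMeasurable hmeas) C ?_
    filter_upwards [hC'] with x hx
    rw [Complex.norm_real, Real.norm_of_nonneg ((inv_pos.2 hC0).le.trans hx.1)]
    exact hx.2
  have hfi : MemLp (fun x => ((f x)⁻¹ : ℂ)) ⊤ (muG l a f) := by
    refine memLp_top_of_bound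
      (Complex.continuous_ofReal.comp_aestronglyMeasurable
        hmeas).aemeasurable.inv.aestronglyMeasurable C ?_
    filter_upwards [hC'] with x hx
    have h0 : 0 < f x := (inv_pos.2 hC0).trans_le hx.1
    change ‖((f x : ℂ))⁻¹‖ ≤ C
    rw [norm_inv, Complex.norm_real, Real.norm_of_nonneg h0.le]
    exact inv_le_of_inv_le₀ hC0 hx.1
  obtain ⟨N, hN⟩ := exists_mul_clm hfi
  obtain ⟨Q, hQ⟩ := exists_mul_clm hfm
  have hQN (u : L2G l a f) : Q (N u) = u := by
    ext1
    filter_upwards [hQ (N u), hN u, hC'] with x h1 h2 h3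
    have h0 : f x ≠ 0 := ((inv_pos.2 hC0).trans_le h3.1).ne'
    rw [h1, h2, ← mul_assoc, mul_inv_cancel₀ (Complex.ofReal_ne_zero.2 h0), one_mul]
  -- the traces
  obtain ⟨T₁, hT₁, hT₁ε⟩ := exists_trace_clm (f := f) hC0 hC (s := a)
    (w := fun n => endWeight a (n + 1)) (fun n => contDiff_endWeight a _)
    (tendsto_eLpNorm_endWeight ha) fun n u hu => trace_top_ae_eq hl ha hu (contDiff_endWeight a _)
      (endWeight_right ha _) (endWeight_left n.succ_ne_zero)
  obtain ⟨T₂, hT₂, hT₂ε⟩ := exists_trace_clm (f := f) hC0 hC (s := -a)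
    (w := fun n y => -endWeight a (n + 1) (-y)) (fun n => (contDiff_endWeight_neg a _).neg)
    (tendsto_eLpNorm_endWeight_neg ha) fun n u hu =>
      trace_bot_ae_eq hl ha hu (contDiff_endWeight_neg a _).neg
        (by simp only [endWeight_left n.succ_ne_zero, neg_zero])
        (by simp only [neg_neg, endWeight_right ha])
  let P (i : Fin 3) : V →L[ℂ] L2G l a f := component l a f i ∘L V.subtypeL
  let t : V →L[ℂ] SideL2 l := T₁ ∘L V.subtypeL
  let b : V →L[ℂ] SideL2 l := T₂ ∘L V.subtypeL
  let A : V →L[ℂ] V := (N ∘L P 1).adjoint ∘L (N ∘L P 1) + (P 2).adjoint ∘L P 2 +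
    (t.adjoint ∘L (M₁₁ ∘L t + M₁₂ ∘L b) + b.adjoint ∘L (M₂₁ ∘L t + M₂₂ ∘L b))
  have hA (φ v : V) : inner ℂ φ (A v) =
      inner ℂ (N (P 1 φ)) (N (P 1 v)) + inner ℂ (P 2 φ) (P 2 v) +
        (inner ℂ (t φ) (M₁₁ (t v) + M₁₂ (b v)) + inner ℂ (b φ) (M₂₁ (t v) + M₂₂ (b v))) := by
    have e : A v = (N ∘L P 1).adjoint (N (P 1 v)) + (P 2).adjoint (P 2 v) +
      (t.adjoint (M₁₁ (t v) + M₁₂ (b v)) + b.adjoint (M₂₁ (t v) + M₂₂ (b v))) := rfl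
    rw [e, inner_add_right, inner_add_right, inner_add_right,
      ContinuousLinearMap.adjoint_inner_right, ContinuousLinearMap.adjoint_inner_right,
      ContinuousLinearMap.adjoint_inner_right, ContinuousLinearMap.adjoint_inner_right]
    rfl
  have hhA (φ v : V) : h (P 0 φ) (P 0 v) = inner ℂ φ (A v) := by
    obtain ⟨hφ, hφ1, hφ2⟩ := (hV φ).1 φ.2
    obtain ⟨hv, hv1, hv2⟩ := (hV v).1 v.2
    refine (hh _ _ (t φ) (b φ) (t v) (b v) (hT₁ φ hφ.1 hφ2) (hT₂ φ hφ.1 hφ2) (hT₁ v hv.1 hv2)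
      (hT₂ v hv.1 hv2)).trans ?_
    rw [hA]
    exact congrArg (· + _) (form1_eq_inner hC0 hC hN hφ1 hφ2 hv1 hv2)
  have hinj : Function.Injective (P 0) := by
    intro v w (hvw : (v : Triples l a f) 0 = (w : Triples l a f) 0)
    obtain ⟨-, hv1, hv2⟩ := (hV v).1 v.2
    obtain ⟨-, hw1, hw2⟩ := (hV w).1 w.2
    have hae {p q : ℝ × ℝ → ℂ} (hpq : p =ᵐ[lebRect l a] q) : p =ᵐ[muG l a f] q := by
      rw [EventuallyEq, ae_muG_eq hC0 hC]; exact hpq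
    rw [hvw] at hv1 hv2
    refine Subtype.ext (PiLp.ext fun i => ?_)
    fin_cases i
    · exact hvw
    · exact Lp.ext (hae (hv1.symm.trans hw1))
    · exact Lp.ext (hae (hv2.symm.trans hw2))
  have hdense : DenseRange (P 0) := by
    change Dense ((P 0).range : Set (L2G l a f))
    rw [Submodule.dense_iff_topologicalClosure_eq_top, Submodule.topologicalClosure_eq_top_iff,
      Submodule.eq_bot_iff]
    intro F hF
    refine eq_zero_of_orthogonal_memW12per hl ha hf hC0 hC fun φ hφ => ?_
    obtain ⟨v, hv⟩ := hVof hφ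
    exact hF φ ⟨v, hv⟩
  -- the Gårding inequality: with this `ε` the boundary form costs at most half of `‖∂₂ u‖²`
  obtain ⟨c, κ, hc, hgard⟩ : ∃ c κ : ℝ, 0 < c ∧
      ∀ v : V, c * ‖v‖ ^ 2 ≤ (inner ℂ v (A v)).re + κ * ‖P 0 v‖ ^ 2 := by
    set S := ‖M₁₁‖ + ‖M₁₂‖ + ‖M₂₁‖ + ‖M₂₂‖ with hS
    have hS0 : 0 ≤ S := by positivity
    obtain ⟨K₁, hK₁⟩ := hT₁ε (1 / (8 * (S + 1))) (by positivity)
    obtain ⟨K₂, hK₂⟩ := hT₂ε (1 / (8 * (S + 1))) (by positivity)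
    set d := ‖Q‖ + 1 with hd
    have hd0 : 0 < d := by positivity
    refine ⟨min (1 / d ^ 2) (1 / 2), 2 * S * (K₁ + K₂) + 1, by positivity, fun v => ?_⟩
    obtain ⟨hv, -, hv2⟩ := (hV v).1 v.2
    have h1 : ‖t v‖ ^ 2 ≤ _ := hK₁ v hv.1 hv2
    have h2 : ‖b v‖ ^ 2 ≤ _ := hK₂ v hv.1 hv2
    have h3 : ‖P 1 v‖ ≤ d * ‖N (P 1 v)‖ := by
      conv_lhs => rw [← hQN (P 1 v)]
      refine (Q.le_opNorm _).trans ?_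
      gcongr
      linarith
    have h4 : 1 / d ^ 2 * ‖P 1 v‖ ^ 2 ≤ ‖N (P 1 v)‖ ^ 2 := by
      rw [one_div_mul_eq_div, div_le_iff₀ (by positivity), mul_comm, ← mul_pow]
      gcongr
    have h5 := (abs_le.1 (abs_boundary_form_le M₁₁ M₁₂ M₂₁ M₂₂ (t v) (b v))).1
    have h6 : ‖v‖ ^ 2 = ‖P 0 v‖ ^ 2 + ‖P 1 v‖ ^ 2 + ‖P 2 v‖ ^ 2 :=
      norm_sq_triple (v : Triples l a f)
    have h7 (x : L2G l a f) : (inner ℂ x x).re = ‖x‖ ^ 2 := by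
      simpa using re_mul_inner_self 1 x
    rw [hA, Complex.add_re, Complex.add_re, h7, h7]
    change ‖t v‖ ^ 2 ≤ 1 / (8 * (S + 1)) * ‖P 2 v‖ ^ 2 + K₁ * ‖P 0 v‖ ^ 2 at h1
    change ‖b v‖ ^ 2 ≤ 1 / (8 * (S + 1)) * ‖P 2 v‖ ^ 2 + K₂ * ‖P 0 v‖ ^ 2 at h2
    have h8 : 2 * S * (‖t v‖ ^ 2 + ‖b v‖ ^ 2) ≤
        1 / 2 * ‖P 2 v‖ ^ 2 + 2 * S * (K₁ + K₂) * ‖P 0 v‖ ^ 2 := by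
      have h9 : 2 * S * (2 * (1 / (8 * (S + 1)))) ≤ 1 / 2 := by
        have e : 2 * S * (2 * (1 / (8 * (S + 1)))) = S / (2 * (S + 1)) := by field_simp; ring
        rw [e, div_le_div_iff₀ (by positivity) (by norm_num)]
        linarith
      calc _ ≤ 2 * S * (2 * (1 / (8 * (S + 1))) * ‖P 2 v‖ ^ 2 + (K₁ + K₂) * ‖P 0 v‖ ^ 2) := by
            refine mul_le_mul_of_nonneg_left ?_ (by positivity)
            linarith
        _ = 2 * S * (2 * (1 / (8 * (S + 1)))) * ‖P 2 v‖ ^ 2 +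
            2 * S * (K₁ + K₂) * ‖P 0 v‖ ^ 2 := by ring
        _ ≤ _ := by gcongr
    have h10 : min (1 / d ^ 2) (1 / 2) * ‖P 1 v‖ ^ 2 ≤ 1 / d ^ 2 * ‖P 1 v‖ ^ 2 := by
      gcongr; exact min_le_left _ _
    have h11 : min (1 / d ^ 2) (1 / 2) * ‖P 2 v‖ ^ 2 ≤ 1 / 2 * ‖P 2 v‖ ^ 2 := by
      gcongr; exact min_le_right _ _
    have h12 : min (1 / d ^ 2) (1 / 2) * ‖P 0 v‖ ^ 2 ≤ 1 * ‖P 0 v‖ ^ 2 := by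
      gcongr; exact (min_le_right _ _).trans (by norm_num)
    rw [h6]
    linarith
  have hiff {x y : L2G l a f} := formOperator_iff (A := A) hinj hdense (x := x) (y := y)
  have hper (v : V) : MemW12per l a (P 0 v) := ((hV v).1 v.2).1
  have hacc := formOperator_isQuasiMAccretive hinj hdense hc hgard
  refine ⟨formOperator (P 0) A, ⟨formOperator_dense_domain hinj hdense hc hgard,
    formOperator_isSectorial hinj hdense hc hgard, hacc⟩, fun ψ => ?_, fun ψ => ?_,
    fun T' hT' hrep => hT'.2.2.eq_of_le hacc ?_⟩
  · obtain ⟨v, hv, hv'⟩ := formOperator_inner hinj hdense ψ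
    rw [← hv]
    refine ⟨hper v, fun φ hφ => ?_⟩
    obtain ⟨w, rfl⟩ := hVof hφ
    exact (hhA w v).trans (hv' w)
  · constructor
    · intro hψ
      obtain ⟨v, hv, hv'⟩ := hiff.1 ⟨hψ, rfl⟩
      rw [← hv]
      refine ⟨hper v, formOperator (P 0) A ⟨ψ, hψ⟩, fun φ hφ => ?_⟩
      obtain ⟨w, rfl⟩ := hVof hφ
      exact (hhA w v).trans (hv' w)
    · rintro ⟨hψ, F, hF⟩
      obtain ⟨v, rfl⟩ := hVof hψ
      exact (hiff.2 ⟨v, rfl, fun w => (hhA w v).symm.trans (hF _ (hper w))⟩).1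
  · have key (x : T'.domain) : ∃ hx : (x : L2G l a f) ∈ (formOperator (P 0) A).domain,
        formOperator (P 0) A ⟨x, hx⟩ = T' x := by
      obtain ⟨h1, h2⟩ := hrep x
      obtain ⟨v, hv⟩ := hVof h1
      exact hiff.2 ⟨v, hv, fun w => by
        rw [← hhA w v, ← h2 _ (hper w), ← hv]; rfl⟩
    refine ⟨fun x hx => (key ⟨x, hx⟩).1, fun x y hxy => ?_⟩
    obtain ⟨hx, hx'⟩ := key x
    rw [← hx']
    exact congrArg _ (Subtype.ext hxy)

end OperatorOfForm
/-! ### Boundary values of the metric coefficient and the boundary coefficients -/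

section Coefficients

variable {l a : ℝ} {f : ℝ × ℝ → ℝ} {C : ℝ}

theorem exists_mem_Ioo_of_ae {c d : ℝ} (hcd : c < d) {p : ℝ → Prop}
    (hp : ∀ᵐ y ∂(volume.restrict (Ioo c d)), p y) : ∃ y ∈ Ioo c d, p y := by
  have : NeBot (ae (volume.restrict (Ioo c d))) := by
    rw [ae_neBot, Ne, Measure.restrict_eq_zero, Real.volume_Ioo, ENNReal.ofReal_eq_zero]
    linarith
  exact ((ae_restrict_mem measurableSet_Ioo).and hp).exists

theorem frequently_nhdsLT_of_ae (ha : 0 < a) {p : ℝ → Prop}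
    (hp : ∀ᵐ y ∂(volume.restrict (Ioo (-a) a)), p y) : ∃ᶠ y in 𝓝[<] a, p y := by
  intro h
  obtain ⟨c, hc, hc'⟩ := (mem_nhdsLT_iff_exists_Ioo_subset' (show -a < a by linarith)).1 h
  obtain ⟨y, hy, hy'⟩ := exists_mem_Ioo_of_ae (max_lt hc (show -a < a by linarith))
    (ae_restrict_of_ae_restrict_of_subset (Ioo_subset_Ioo_left (le_max_right c (-a))) hp)
  exact hc' ⟨(le_max_left _ _).trans_lt hy.1, hy.2⟩ hy'

theorem frequently_nhdsGT_of_ae (ha : 0 < a) {p : ℝ → Prop}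
    (hp : ∀ᵐ y ∂(volume.restrict (Ioo (-a) a)), p y) : ∃ᶠ y in 𝓝[>] (-a), p y := by
  intro h
  obtain ⟨c, hc, hc'⟩ := (mem_nhdsGT_iff_exists_Ioo_subset' (show -a < a by linarith)).1 h
  obtain ⟨y, hy, hy'⟩ := exists_mem_Ioo_of_ae (lt_min hc (show -a < a by linarith))
    (ae_restrict_of_ae_restrict_of_subset (Ioo_subset_Ioo_right (min_le_right c a)) hp)
  exact hc' ⟨hy.1, hy.2.trans_le (min_le_left _ _)⟩ hy'

/-- The boundary values of `f` are essentially bounded: they are limits of sections of `f`, almost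
all of which are measurable with the same bound. -/
theorem memLp_top_boundary_value (hf : AEMeasurable f (lebRect l a)) (hC0 : 0 < C)
    (hC : ∀ᵐ x ∂(lebRect l a), C⁻¹ ≤ f x ∧ f x ≤ C) {s : ℝ} {F : Filter ℝ}
    [F.IsCountablyGenerated]
    (hF : ∀ p : ℝ → Prop, (∀ᵐ y ∂(volume.restrict (Ioo (-a) a)), p y) → ∃ᶠ y in F, p y)
    (hlim : ∀ᵐ x ∂(volume.restrict (Ioo (-l) l)), Tendsto (fun y => f (x, y)) F (𝓝 (f (x, s)))) :
    MemLp (fun x => (f (x, s) : ℂ)) ⊤ (volume.restrict (Ioo (-l) l)) := by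
  have hsw := measurePreserving_swap_lebRect l a
  have h1 : AEStronglyMeasurable (fun z => f z.swap) (lebRect a l) :=
    hf.aestronglyMeasurable.comp_measurePreserving hsw
  have h2 : ∀ᵐ z ∂(lebRect a l), ‖f z.swap‖ ≤ C := by
    filter_upwards [hsw.quasiMeasurePreserving.ae hC] with z hz
    rw [Real.norm_of_nonneg ((inv_pos.2 hC0).le.trans hz.1)]
    exact hz.2
  rw [lebRect_eq_prod] at h1 h2
  obtain ⟨y, hy, hy'⟩ := exists_seq_forall_of_frequently
    (hF _ (h1.prodMk_left.and (Measure.ae_ae_of_ae_prod h2)))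
  have hmeas : AEStronglyMeasurable (fun x => f (x, s)) (volume.restrict (Ioo (-l) l)) :=
    aestronglyMeasurable_of_tendsto_ae atTop (fun n => (hy' n).1)
      (hlim.mono fun x hx => hx.comp hy)
  refine memLp_top_of_bound (Complex.continuous_ofReal.comp_aestronglyMeasurable hmeas) C ?_
  filter_upwards [hlim, ae_all_iff.2 fun n => (hy' n).2] with x h3 h4
  rw [Complex.norm_real]
  exact le_of_tendsto (h3.comp hy).norm (Eventually.of_forall h4)

variable {ρ : Measure ℝ} {b c ϕ : ℝ → ℝ}

theorem memLp_top_mul {m m' : ℝ → ℂ} (hm : MemLp m ⊤ ρ) (hm' : MemLp m' ⊤ ρ) :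
    MemLp (fun x => m x * m' x) ⊤ ρ :=
  MemLp.mul (p := ⊤) (q := ⊤) (r := ⊤) hm' hm

theorem memLp_top_sqrt (hb : MemLp b ⊤ ρ) (hc : MemLp c ⊤ ρ) :
    MemLp (fun s => (Real.sqrt (1 + b s * c s) : ℂ)) ⊤ ρ := by
  have h0 : MemLp (fun s => b s * c s) ⊤ ρ := MemLp.mul (p := ⊤) (q := ⊤) (r := ⊤) hc hb
  have hone : MemLp (fun _ => (1 : ℝ)) ⊤ ρ := memLp_top_const 1
  have h1 : MemLp (fun s => 1 + b s * c s) ⊤ ρ := hone.add h0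
  have h3 : MemLp (fun s => 1 + |1 + b s * c s|) ⊤ ρ := hone.add h1.abs
  have hs : AEStronglyMeasurable (fun s => Real.sqrt (1 + b s * c s)) ρ :=
    Real.continuous_sqrt.comp_aestronglyMeasurable h1.1
  have h4 : MemLp (fun s => Real.sqrt (1 + b s * c s)) ⊤ ρ := by
    refine h3.mono hs (ae_of_all _ fun s => ?_)
    rw [Real.norm_of_nonneg (Real.sqrt_nonneg _), Real.norm_of_nonneg (by positivity)]
    rw [Real.sqrt_le_left (by positivity)]
    nlinarith [le_abs_self (1 + b s * c s), abs_nonneg (1 + b s * c s)]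
  exact h4.ofReal

theorem memLp_top_exp (hϕ : AEStronglyMeasurable ϕ ρ) :
    MemLp (fun s => Complex.exp (Complex.I * (ϕ s : ℂ))) ⊤ ρ := by
  have hcont : Continuous fun t : ℝ => Complex.exp (Complex.I * (t : ℂ)) := by fun_prop
  refine memLp_top_of_bound (hcont.comp_aestronglyMeasurable hϕ) 1 (ae_of_all _ fun s => ?_)
  rw [mul_comm, Complex.norm_exp_ofReal_mul_I]

end Coefficients

end PTStrip

theorem corollary3p1 (l a : ℝ) (hl : 0 < l) (ha : 0 < a)
    (f : ℝ × ℝ → ℝ)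
    (hf_pos : ∀ᵐ x ∂(volume.restrict (rect l a)), 0 < f x)
    (hf : MemLp f ⊤ (volume.restrict (rect l a)))
    (hf_inv : MemLp (fun x => (f x)⁻¹) ⊤ (volume.restrict (rect l a)))
    -- the values of `f` on the sides `x₂ = ± a` are its boundary limits
    (hf_top : ∀ᵐ s ∂(volume.restrict (Ioo (-l) l)),
      Tendsto (fun y => f (s, y)) (𝓝[<] a) (𝓝 (f (s, a))))
    (hf_bot : ∀ᵐ s ∂(volume.restrict (Ioo (-l) l)),
      Tendsto (fun y => f (s, y)) (𝓝[>] (-a)) (𝓝 (f (s, -a))))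
    (α β b c ϕ : ℝ → ℝ)
    (hα : MemLp α ⊤ (volume.restrict (Ioo (-l) l)))
    (hβ : MemLp β ⊤ (volume.restrict (Ioo (-l) l)))
    (hb : MemLp b ⊤ (volume.restrict (Ioo (-l) l)))
    (hb_inv : MemLp (fun s => 1 / b s) ⊤ (volume.restrict (Ioo (-l) l)))
    (hc : MemLp c ⊤ (volume.restrict (Ioo (-l) l)))
    (hϕ : AEStronglyMeasurable ϕ (volume.restrict (Ioo (-l) l)))
    (hb_pos : ∀ᵐ s ∂(volume.restrict (Ioo (-l) l)), 0 < b s)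
    (hc_ge : ∀ᵐ s ∂(volume.restrict (Ioo (-l) l)), -(1 / b s) ≤ c s)
    (hϕ_mem : ∀ᵐ s ∂(volume.restrict (Ioo (-l) l)), ϕ s ∈ Ico (-Real.pi) Real.pi) :
    (∃ T : L2G l a f →ₗ.[ℂ] L2G l a f,
      IsMSectorial T ∧ Represents (formI l a f α β) T ∧
      (∀ ψ : L2G l a f, ψ ∈ T.domain ↔ MemFormOpDomain (formI l a f α β) ψ) ∧
      ∀ T' : L2G l a f →ₗ.[ℂ] L2G l a f,
        IsMSectorial T' → Represents (formI l a f α β) T' → T' = T) ∧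
    (∃ T : L2G l a f →ₗ.[ℂ] L2G l a f,
      IsMSectorial T ∧ Represents (formII l a f b c ϕ) T ∧
      (∀ ψ : L2G l a f, ψ ∈ T.domain ↔ MemFormOpDomain (formII l a f b c ϕ) ψ) ∧
      ∀ T' : L2G l a f →ₗ.[ℂ] L2G l a f,
        IsMSectorial T' → Represents (formII l a f b c ϕ) T' → T' = T) := by
  obtain ⟨C, hC0, hC⟩ := exists_ae_bounds hf_pos hf hf_inv
  have hfm : AEMeasurable f (lebRect l a) := hf.1.aemeasurable
  have hft := memLp_top_boundary_value hfm hC0 hC (s := a)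
    (fun p hp => frequently_nhdsLT_of_ae ha hp) hf_top
  have hfb := memLp_top_boundary_value hfm hC0 hC (s := -a)
    (fun p hp => frequently_nhdsGT_of_ae ha hp) hf_bot
  constructor
  · have hα' : MemLp (fun s => Complex.I * (α s : ℂ)) ⊤ (volume.restrict (Ioo (-l) l)) :=
      (hα.ofReal (K := ℂ)).const_mul Complex.I
    have hβ' : MemLp (fun s => (β s : ℂ)) ⊤ (volume.restrict (Ioo (-l) l)) := hβ.ofReal
    have hp : MemLp (fun s => (β s : ℂ) + Complex.I * (α s : ℂ)) ⊤
        (volume.restrict (Ioo (-l) l)) := hβ'.add hα'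
    have hm : MemLp (fun s => (β s : ℂ) - Complex.I * (α s : ℂ)) ⊤
        (volume.restrict (Ioo (-l) l)) := hβ'.sub hα'
    obtain ⟨M, hM⟩ := exists_mul_clm (memLp_top_mul hp hft)
    obtain ⟨M', hM'⟩ := exists_mul_clm (memLp_top_mul hm hfb)
    refine exists_unique_operator hl ha hfm hC0 hC (formI l a f α β) M 0 0 M'
      fun φ ψ tφ bφ tψ bψ h1 h2 h3 h4 => ?_
    rw [formI, bdryInner_eq_inner hM h1 h3 fun x => rfl, bdryInner_eq_inner hM' h2 h4 fun x => rfl]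
    simp
  · have hbi : MemLp (fun s => (b s : ℂ)⁻¹) ⊤ (volume.restrict (Ioo (-l) l)) := by
      simpa using hb_inv.ofReal (K := ℂ)
    have hsq := memLp_top_sqrt hb hc
    have he := memLp_top_exp hϕ
    have he' : MemLp (fun s => Complex.exp (-(Complex.I * (ϕ s : ℂ)))) ⊤
        (volume.restrict (Ioo (-l) l)) := by
      simpa using memLp_top_exp hϕ.neg
    obtain ⟨M₁₁, h₁₁⟩ := exists_mul_clm
      (memLp_top_mul (memLp_top_mul (memLp_top_mul hsq he') hbi) hft)
    obtain ⟨M₁₂, h₁₂⟩ := exists_mul_clm (memLp_top_mul hbi hft)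
    obtain ⟨M₂₁, h₂₁⟩ := exists_mul_clm (memLp_top_mul hbi hfb)
    obtain ⟨M₂₂, h₂₂⟩ := exists_mul_clm
      (memLp_top_mul (memLp_top_mul (memLp_top_mul hsq he) hbi) hfb)
    refine exists_unique_operator hl ha hfm hC0 hC (formII l a f b c ϕ) (-M₁₁) M₁₂ M₂₁ (-M₂₂)
      fun φ ψ tφ bφ tψ bψ h1 h2 h3 h4 => ?_
    rw [formII, bdryInner_eq_inner h₁₂ h1 h4 fun x => rfl,
      bdryInner_eq_inner h₂₁ h2 h3 fun x => by simp [matB, parity],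
      bdryInner_eq_inner h₁₁ h1 h3 fun x => rfl, bdryInner_eq_inner h₂₂ h2 h4 fun x => rfl]
    simp only [neg_apply, inner_add_right, inner_neg_right]
    ring
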